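/- **Setting.** Let $m\ge 0$ be an integer, let $\{1,\dots,2m\}=J^+\sqcup J^-$, let $c_j:[0,1]\to(0,\infty)$ ($1\le j\le 2m$) be continuous (for instance constant) and let $\Xi_{out},\Xi_{in}$ be real $2m\times 2m$ matrices. Consider the system $$\partial_t\upsilon_j=-c_j\,\partial_x\upsilon_j\ (j\in J^+),\qquad \partial_t\varpi_j=c_j\,\partial_x\varpi_j\ (j\in J^-),\qquad 0<x<1,$$ $$\Xi_{out}(\upsilon(0),\varpi(1))^T+\Xi_{in}(\upsilon(1),\varpi(0))^T=0,\tag{1}$$ where the column $j$ of both matrices belongs to the component $j$. For a matrix $B$ let $\widehat B$ be obtained from $B$ by replacing every nonzero entry by $1$, and let $\operatorname{supp}$ denote the set of indices of the nonzero entries of a row or column. **Networks.** Let $\Gamma$ be a finite simple graph without isolated vertices with $m$ edges, each parametrized by $[0,1]$, carrying on its edge $e_j$ a system $\partial_tp^j+M^j\partial_xp^j=0$ whose real $2\times2$ matrices $M^j(x)$ have eigenvalues $\lambda^j_-(x)<\lambda^j_+(x)$, each of constant nonzero sign on $[0,1]$, and let $u^j=(F^j)^{-1}p^j$ be the Riemann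 invariants, where the columns of $F^j(x)$ are eigenvectors of $M^j(x)$ for $\lambda_+^j,\lambda_-^j$. Each of the $2m$ Riemann invariants flows along its edge from $0$ to $1$ if its eigenvalue is positive and from $1$ to $0$ if it is negative; accordingly its value is outgoing at one end and incoming at the other. Let $k_v$ be the number of the values outgoing at the vertex $v$. A sink is a vertex without outgoing values, a source one without incoming values, and the other vertices are transient. Kirchhoff conditions are given by a real matrix $\Phi_v$ with $k_v$ rows at every vertex $v$, that is, $\Phi_vp(v)=0$, or $\Psi_vu(v)=0$ with $\Psi_v=\Phi_vF(v)$; $\Psi_v^{out}$ and $\Psi_v^{in}$ consist of the columns of $\Psi_v$ for the outgoing and the incoming values. There are no conditions at sinks. System (1) is called *graph realizable* if there are such $\Gamma$, $M^j$, $\Phi_v$, a bijection between the components $1,\dots,2m$ and the Riemann invariants of the network, under which the eigenvalue is $c_j$ for $j\in J^+$ and $-c_j$ for $j\in J^-$, and a bijection between the rows $1,\dots,2m$ and all the Kirchhoff conditions, under which $\Xi_{out}$ and $\Xi_{in}$ become the matrices acting on the outgoing and on the incoming values in the system of all Kirchhoff conditions, and if * $\Psi^{out}_v$ has no zero row and no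 zero column, for every $v$ that is not a sink; * for every transient $v$, each incoming and each outgoing value both occur with a nonzero coefficient in some common row of $\Psi_v$; * for every source $v$, the matrix $C_v$ is irreducible, where $(C_v)_{ij}=1$ if the outgoing values $i,j$ both occur with a nonzero coefficient in some common row of $\Psi_v$, and $(C_v)_{ij}=0$ otherwise. **Conditions.** * (a) $\Xi_{out}$ has no zero row and no zero column. * (b) $\mathsf A:=\widehat{(\widehat{\Xi_{out}})^T\,\widehat{\Xi_{in}}}$ is the adjacency matrix of the line digraph of a loopless multi digraph with arcs $1,\dots,2m$ (that is, $\mathsf A_{ij}=1$ if the head of the arc $j$ is the tail of the arc $i$, and $\mathsf A_{ij}=0$ otherwise). * (c) For every $i$ with zero $i$-th row of $\Xi_{in}$, the support of the $i$-th row of $\Xi_{out}$ lies in one class of indices of equal rows of $\mathsf A$. **Reconstruction.** The transient vertices correspond to the classes $G$ of indices of equal nonzero rows of $\mathsf A$; the outgoing arcs are the elements of $G$ and the incoming arcs are the $q$ with $\mathsf A_{pq}=1$ for some $p\in G$. Let $V^{out}_S$ and $V^{in}_Z$ be the sets of indices of zero rows and of zero columns of $\mathsf A$. Let $\Xi^S_{out}$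 be the submatrix of $\Xi_{out}$ with the columns in $V^{out}_S$ and the rows whose support in $\Xi_{out}$ lies in $V^{out}_S$. The sources correspond to the irreducible diagonal blocks of the symmetric matrix $\widehat{(\widehat{\Xi^S_{out}})^T\,\widehat{\Xi^S_{out}}}$; the index set of a block is the set of arcs outgoing from the source, and no arcs are incoming. For each of these vertices $v$ let $\mathcal V_v$ be the union of the supports of the columns of $\Xi_{out}$ of the arcs outgoing from $v$, and let $V^{in}_{\mathcal V_v}$ be the set of the $j\in V^{in}_Z$ for which the support of the $j$-th column of $\Xi_{out}$ meets $\mathcal V_v$. Given a partition of each $V^{in}_{\mathcal V_v}$ into nonempty sets, add one sink for each part, whose incoming arcs are the elements of the part, without outgoing arcs. Let $A^+,A^-$ be the $0$–$1$ matrices (vertices $\times$ arcs) of incoming and of outgoing arcs and $A(\mathbf\Gamma)=(a_{ij})=A^+(A^-)^T$, so that $a_{ij}$ is the number of arcs from $j$ to $i$. * (d) There is a choice of partitions of the sets $V^{in}_{\mathcal V_v}$ such that 1. $a_{ii}=0$ for all $i$, and $(a_{ij},a_{ji})\in\{(2,0),(1,1),(0,2),(0,0)\}$ for all $i,j$; 2.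 if $k\neq l$ are the two arcs between $i$ and $j$, then: if $(a_{ij},a_{ji})$ is $(2,0)$ or $(0,2)$, both $k,l$ are in $J^+$ or both are in $J^-$, and $c_k(x)\ne c_l(x)$ for all $x\in[0,1]$; if $(a_{ij},a_{ji})=(1,1)$, one of $k,l$ is in $J^+$ and the other one in $J^-$. * (e) (neither under- nor overdetermined) For every transient vertex and every source $v$ of the reconstruction, $|\mathcal V_v|$ equals the number of arcs outgoing from $v$. **Theorem.** 1. System (1) is graph realizable if and only if (a), (b), (c), (d) and (e) hold. 2. If $\Xi_{out}$ is nonsingular (so that the outgoing boundary values are determined by the incoming ones), then (1) is graph realizable if and only if (a), (b), (c) and (d) hold. 3. If $m\ge1$ and the boundary conditions do not split into two systems without common unknowns (that is, the only sets $T\subset\{1,\dots,2m\}$ such that for every $i$ the union of the supports of the $i$-th rows of $\Xi_{out}$ and $\Xi_{in}$ lies in $T$ or in its complement are $\emptyset$ and $\{1,\dots,2m\}$), then every graph $\Gamma$ realizing (1) in this sense is connected. -/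

import Mathlib

open Set

noncomputable section

/-- The matrix obtained from `A` by replacing every nonzero entry by `1`. -/
def hat {ι κ R : Type*} [Zero R] (A : Matrix ι κ R) : Matrix ι κ ℤ :=
  open Classical in fun i j => if A i j = 0 then 0 else 1

/-- A finite directed multigraph without loops, with vertices `V` and arcs `E`. -/
structure MultiDigraph (V E : Type*) where
  tail : E → V
  head : E → V
  loopless : ∀ e, tail e ≠ head e

/-- The adjacency matrix of the line digraph: the entry `(i, j)` is `1` if the arc `j` ends at the
vertex from which the arc `i` starts, and `0` otherwise. -/
def MultiDigraph.lineAdj {V E : Type*} (G : MultiDigraph V E) : Matrix E E ℤ :=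
  open Classical in fun i j => if G.head j = G.tail i then 1 else 0

/-- `A` is the adjacency matrix of the line digraph of a finite loopless multi digraph. -/
def IsLineDigraphMatrix {E : Type*} (A : Matrix E E ℤ) : Prop :=
  ∃ (n : ℕ) (G : MultiDigraph (Fin n) E), A = G.lineAdj

/-! ### The diagonal first order system on the interval -/

/-- The system `∂ₜυⱼ = -cⱼ ∂ₓυⱼ` (for `j ∈ Jplus`), `∂ₜϖⱼ = cⱼ ∂ₓϖⱼ` (for `j ∉ Jplus`) on `[0,1]`
with the boundary conditions `Xout (υ(0), ϖ(1)) + Xin (υ(1), ϖ(0)) = 0`. The components of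
`(υ, ϖ)` are numbered by `Fin (2 * m)`; `Jplus` is the set of the numbers of the components of `υ`,
its complement is the set of those of `ϖ`. -/
structure PortHamiltonian (m : ℕ) where
  Jplus : Finset (Fin (2 * m))
  c : Fin (2 * m) → ℝ → ℝ
  c_cont : ∀ j, ContinuousOn (c j) (Icc 0 1)
  c_pos : ∀ j, ∀ x ∈ Icc (0 : ℝ) 1, 0 < c j x
  Xout : Matrix (Fin (2 * m)) (Fin (2 * m)) ℝ
  Xin : Matrix (Fin (2 * m)) (Fin (2 * m)) ℝ

/-! ### Networks of `2 × 2` hyperbolic systems with Kirchhoff conditions -/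

/-- A simple graph with vertices `Fin r` and edges numbered by `Fin m`; each edge `j` is identified
with `[0,1]` so that its end `tail j` corresponds to `0` and `head j` to `1`. On the edge `j` there
is a system `∂ₜp + M j ∂ₓp = 0` with a strictly hyperbolic `2 × 2` matrix `M j x`, whose eigenvalues
are `lam j 1 x < lam j 0 x` (that is, `λ₋ < λ₊`), each of a constant sign on `[0,1]`;
`F j x` is the matrix of eigenvectors, so that `u = F⁻¹ p` are the Riemann invariants. -/
structure Network (r m : ℕ) where
  graph : SimpleGraph (Fin r)
  edge : Fin m ≃ graph.edgeSet
  tail : Fin m → Fin r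
  head : Fin m → Fin r
  edge_eq : ∀ j, (edge j : Sym2 (Fin r)) = s(tail j, head j)
  no_isolated : ∀ v, ∃ j, tail j = v ∨ head j = v
  M : Fin m → ℝ → Matrix (Fin 2) (Fin 2) ℝ
  lam : Fin m → Fin 2 → ℝ → ℝ
  F : Fin m → ℝ → Matrix (Fin 2) (Fin 2) ℝ
  hyperbolic : ∀ j, ∀ x ∈ Icc (0 : ℝ) 1, lam j 1 x < lam j 0 x
  sign : ∀ j k, (∀ x ∈ Icc (0 : ℝ) 1, 0 < lam j k x) ∨ (∀ x ∈ Icc (0 : ℝ) 1, lam j k x < 0)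
  F_unit : ∀ j, ∀ x ∈ Icc (0 : ℝ) 1, IsUnit (F j x)
  eigen : ∀ j, ∀ x ∈ Icc (0 : ℝ) 1,
    M j x * F j x = F j x * Matrix.diagonal (fun k => lam j k x)

namespace Network

variable {r m : ℕ} (N : Network r m)

/-- The edge `j` is incident to the vertex `v`. -/
def Incident (v : Fin r) (j : Fin m) : Prop := N.tail j = v ∨ N.head j = v

/-- The eigenvalue belonging to the Riemann invariant `a = (k, j)`, the `k`-th one on the edge `j`,
is positive, that is, this component flows from `0` to `1`. -/
def Pos (a : Fin 2 × Fin m) : Prop := ∀ x ∈ Icc (0 : ℝ) 1, 0 < N.lam a.2 a.1 x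

/-- The number of positive eigenvalues on the edge `j`. -/
def alpha (j : Fin m) : ℕ := Nat.card {k : Fin 2 // N.Pos (k, j)}

/-- The value of the Riemann invariant `a` at `v` is outgoing. -/
def IsOut (v : Fin r) (a : Fin 2 × Fin m) : Prop :=
  (N.tail a.2 = v ∧ N.Pos a) ∨ (N.head a.2 = v ∧ ¬ N.Pos a)

/-- The value of the Riemann invariant `a` at `v` is incoming. -/
def IsIn (v : Fin r) (a : Fin 2 × Fin m) : Prop :=
  (N.head a.2 = v ∧ N.Pos a) ∨ (N.tail a.2 = v ∧ ¬ N.Pos a)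

theorem IsOut.incident {N : Network r m} {v : Fin r} {a : Fin 2 × Fin m} (h : N.IsOut v a) :
    N.Incident v a.2 := h.elim (fun h => Or.inl h.1) (fun h => Or.inr h.1)

theorem IsIn.incident {N : Network r m} {v : Fin r} {a : Fin 2 × Fin m} (h : N.IsIn v a) :
    N.Incident v a.2 := h.elim (fun h => Or.inr h.1) (fun h => Or.inl h.1)

/-- The number `k_v` of the outgoing values at `v`. -/
def numOut (v : Fin r) : ℕ := Nat.card {a : Fin 2 × Fin m // N.IsOut v a}

def IsSink (v : Fin r) : Prop :=
  ∀ j, N.Incident v j → (N.alpha j = 2 ∧ N.head j = v) ∨ (N.alpha j = 0 ∧ N.tail j = v)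

def IsSource (v : Fin r) : Prop :=
  ∀ j, N.Incident v j → (N.alpha j = 0 ∧ N.head j = v) ∨ (N.alpha j = 2 ∧ N.tail j = v)

def IsTransient (v : Fin r) : Prop := ¬ N.IsSource v ∧ ¬ N.IsSink v

/-- Generalized Kirchhoff conditions `Phi v * p(v) = 0`: at every vertex `v`, a real matrix with
`k_v` rows acting on the values at `v` of both components of `p` on each edge incident to `v`.
At a sink there are no conditions, since there `k_v = 0`. -/
abbrev Kirchhoff : Type :=
  ∀ v : Fin r, Matrix (Fin (N.numOut v)) (Fin 2 × {j // N.Incident v j}) ℝ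

/-- The parameter in `{0, 1}` to which the end `v` of the edge `j` corresponds. -/
def endpoint (v : Fin r) (j : Fin m) : ℝ := if N.tail j = v then 0 else 1

variable {N} (Phi : N.Kirchhoff)

/-- The Kirchhoff conditions at `v` in terms of the Riemann invariants, `Ψ_v = Φ_v F(v)`. -/
def psi (v : Fin r) : Matrix (Fin (N.numOut v)) (Fin 2 × {j // N.Incident v j}) ℝ :=
  open Classical in
  Phi v * Matrix.blockDiagonal (fun j : {j // N.Incident v j} => N.F j.1 (N.endpoint v j.1))

/-- The columns of `Ψ_v` belonging to the outgoing values at `v`. -/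
def psiOut (v : Fin r) : Matrix (Fin (N.numOut v)) {a // N.IsOut v a} ℝ :=
  fun s a => psi Phi v s (a.1.1, ⟨a.1.2, a.2.incident⟩)

/-- The columns of `Ψ_v` belonging to the incoming values at `v`. -/
def psiIn (v : Fin r) : Matrix (Fin (N.numOut v)) {a // N.IsIn v a} ℝ :=
  fun s a => psi Phi v s (a.1.1, ⟨a.1.2, a.2.incident⟩)

/-- The matrix acting on the outgoing values in the system of all Kirchhoff conditions. -/
def globalOut : Matrix (Σ v : Fin r, Fin (N.numOut v)) (Fin 2 × Fin m) ℝ :=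
  open Classical in
  fun s a => if h : N.IsOut s.1 a then psiOut Phi s.1 s.2 ⟨a, h⟩ else 0

/-- The matrix acting on the incoming values in the system of all Kirchhoff conditions. -/
def globalIn : Matrix (Σ v : Fin r, Fin (N.numOut v)) (Fin 2 × Fin m) ℝ :=
  open Classical in
  fun s a => if h : N.IsIn s.1 a then psiIn Phi s.1 s.2 ⟨a, h⟩ else 0

/-- No row and no column of the outgoing part of the conditions at `v` is zero. -/
def NoZeroOut (v : Fin r) : Prop :=
  (∀ s, ∃ a, psiOut Phi v s a ≠ 0) ∧ (∀ a, ∃ s, psiOut Phi v s a ≠ 0)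

/-- The connectivity matrix at a transient vertex: the entry `(l, j)` is `1` if the incoming `j` is
flow connected to the outgoing `l`, that is, if both occur in one of the conditions at `v`. -/
def transientConn (v : Fin r) : Matrix {a // N.IsOut v a} {a // N.IsIn v a} ℤ :=
  open Classical in
  fun l j => if ∃ s, psiIn Phi v s j ≠ 0 ∧ psiOut Phi v s l ≠ 0 then 1 else 0

/-- The connectivity matrix at a source: the entry `(i, j)` is `1` if the outgoing `i` and `j`
both occur in one of the conditions at `v`. -/
def sourceConn (v : Fin r) : Matrix {a // N.IsOut v a} {a // N.IsOut v a} ℤ :=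
  open Classical in
  fun i j => if ∃ s, psiOut Phi v s i ≠ 0 ∧ psiOut Phi v s j ≠ 0 then 1 else 0

end Network

namespace PortHamiltonian

variable {m : ℕ} (S : PortHamiltonian m)

/-! ### Graph realizability -/

/-- The network `N` with the Kirchhoff conditions `Phi` realizes the system `S`, and these
conditions have no zero row or column in their outgoing part at any vertex that is not a sink, are
fully flow connected at transient vertices and irreducible at sources. Here `σ` tells which Riemann
invariant on which edge each component of `(υ, ϖ)` is, and `ρ` to which vertex each row belongs. -/
def IsRealization {r : ℕ} (N : Network r m) (Phi : N.Kirchhoff) : Prop :=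
  (∃ (ρ : Fin (2 * m) ≃ Σ v : Fin r, Fin (N.numOut v)) (σ : Fin (2 * m) ≃ Fin 2 × Fin m),
    (∀ j ∈ S.Jplus, ∀ x ∈ Icc (0 : ℝ) 1, N.lam (σ j).2 (σ j).1 x = S.c j x) ∧
    (∀ j ∉ S.Jplus, ∀ x ∈ Icc (0 : ℝ) 1, N.lam (σ j).2 (σ j).1 x = -S.c j x) ∧
    S.Xout = (Network.globalOut Phi).submatrix ρ σ ∧
    S.Xin = (Network.globalIn Phi).submatrix ρ σ) ∧
  (∀ v, ¬ N.IsSink v → Network.NoZeroOut Phi v) ∧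
  (∀ v, N.IsTransient v → Network.transientConn Phi v = fun _ _ => 1) ∧
  (∀ v, N.IsSource v → (Network.sourceConn Phi v).IsIrreducible)

def GraphRealizable : Prop :=
  ∃ (r : ℕ) (N : Network r m) (Phi : N.Kirchhoff), S.IsRealization N Phi

/-! ### The conditions on the matrices -/

/-- No column and no row of `Xout` is zero. -/
def NoZeroRowCol : Prop :=
  ∀ j, (∃ i, S.Xout i j ≠ 0) ∧ (∃ i, S.Xout j i ≠ 0)

/-- The potential connection matrix of the arcs. -/
def A : Matrix (Fin (2 * m)) (Fin (2 * m)) ℤ := hat ((hat S.Xout).transpose * hat S.Xin)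

/-- The indices whose rows of `A` are equal to the row `a`. -/
def outClass (a : Fin (2 * m)) : Finset (Fin (2 * m)) :=
  open Classical in Finset.univ.filter (fun j => S.A j = S.A a)

/-- The support of every row of `Xout` for which the row of `Xin` is zero lies in one class of
equal rows of `A`. -/
def ZeroInRowsLocal : Prop :=
  ∀ i, (∀ j, S.Xin i j = 0) → ∃ a, ∀ j, S.Xout i j ≠ 0 → j ∈ S.outClass a

/-! ### The reconstructed multi digraph -/

/-- The sets of the arcs outgoing from a transient vertex: classes of equal nonzero rows of `A`. -/
def transientGroups : Finset (Finset (Fin (2 * m))) :=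
  open Classical in (Finset.univ.filter (fun a => S.A a ≠ 0)).image S.outClass

/-- The arcs outgoing from sources: zero rows of `A`. -/
def sourceArcs : Finset (Fin (2 * m)) :=
  open Classical in Finset.univ.filter (fun a => ∀ j, S.A a j = 0)

/-- The arcs incoming to sinks: zero columns of `A`. -/
def sinkArcs : Finset (Fin (2 * m)) :=
  open Classical in Finset.univ.filter (fun a => ∀ i, S.A i a = 0)

/-- The rows belonging to sources. -/
def sourceRows : Finset (Fin (2 * m)) :=
  open Classical in Finset.univ.filter (fun i => ∀ j, S.Xout i j ≠ 0 → j ∈ S.sourceArcs)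

/-- The part of `Xout` that belongs to sources. -/
def sourceBlock : Matrix {i // i ∈ S.sourceRows} {j // j ∈ S.sourceArcs} ℝ :=
  S.Xout.submatrix Subtype.val Subtype.val

/-- The flow connectivity matrix of the arcs outgoing from sources. -/
def sourceConn : Matrix {j // j ∈ S.sourceArcs} {j // j ∈ S.sourceArcs} ℤ :=
  hat ((hat S.sourceBlock).transpose * hat S.sourceBlock)

/-- `B` is the index set of one of the irreducible diagonal blocks into which the symmetric matrix
`sourceConn` decomposes. -/
def IsSourceGroup (B : Finset {j // j ∈ S.sourceArcs}) : Prop :=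
  B.Nonempty ∧
  (S.sourceConn.submatrix (Subtype.val : {j // j ∈ B} → _) Subtype.val).IsIrreducible ∧
  ∀ i ∈ B, ∀ j ∉ B, S.sourceConn i j = 0

/-- The vertices that are not sinks: the transient ones and the sources. -/
abbrev Vert : Type :=
  {G // G ∈ S.transientGroups} ⊕ {B // S.IsSourceGroup B}

/-- The arcs outgoing from a vertex that is not a sink. -/
def outArcs : S.Vert → Finset (Fin (2 * m))
  | .inl G => G.1
  | .inr B => B.1.map (Function.Embedding.subtype _)

/-- The rows belonging to a vertex that is not a sink: the union of the supports of the columns of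
`Xout` of the arcs outgoing from it. -/
def rowSet (v : S.Vert) : Finset (Fin (2 * m)) :=
  open Classical in Finset.univ.filter (fun i => ∃ s ∈ S.outArcs v, S.Xout i s ≠ 0)

/-- The boundary conditions are neither under- nor overdetermined at any vertex: as many rows as
outgoing arcs. -/
def Balanced : Prop := ∀ v : S.Vert, (S.rowSet v).card = (S.outArcs v).card

/-- The arcs running from the vertex `v` to sinks. -/
def arcsToSinks (v : S.Vert) : Finset (Fin (2 * m)) :=
  open Classical in S.sinkArcs.filter (fun j => ∃ i ∈ S.rowSet v, S.Xout i j ≠ 0)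

/-- A partition, for every vertex, of the set of the arcs running from it to sinks. -/
abbrev SinkPartition : Type := ∀ v : S.Vert, Finpartition (S.arcsToSinks v)

variable {S} (P : S.SinkPartition)

/-- All the vertices; each part of the partitions is the set of the arcs incoming to one sink. -/
abbrev FullVert : Type := S.Vert ⊕ (Σ v : S.Vert, {p // p ∈ (P v).parts})

/-- The incoming incidence matrix. The arcs incoming to a transient vertex are those `q` for which
`A p q ≠ 0` for some arc `p` outgoing from it. -/
def inIncidence : Matrix (FullVert P) (Fin (2 * m)) ℤ :=
  open Classical in fun v q => match v with
  | .inl (.inl G) => if ∃ p ∈ G.1, S.A p q ≠ 0 then 1 else 0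
  | .inl (.inr _) => 0
  | .inr z => if q ∈ z.2.1 then 1 else 0

/-- The outgoing incidence matrix. -/
def outIncidence : Matrix (FullVert P) (Fin (2 * m)) ℤ :=
  fun v q => match v with
  | .inl w => if q ∈ S.outArcs w then 1 else 0
  | .inr _ => 0

/-- The adjacency matrix of the multi digraph; the entry `(i, j)` is the number of arcs running from
`j` to `i`. -/
def adj : Matrix (FullVert P) (FullVert P) ℤ := inIncidence P * (outIncidence P).transpose

/-- Zero diagonal, and between two vertices there are either two arcs or none. -/
def PairForm : Prop :=
  (∀ i, adj P i i = 0) ∧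
  ∀ i j, (adj P i j, adj P j i) ∈ ({(2, 0), (1, 1), (0, 2), (0, 0)} : Set (ℤ × ℤ))

/-- The arcs running from `j` to `i`. -/
def arcs (i j : FullVert P) : Finset (Fin (2 * m)) :=
  open Classical in
  Finset.univ.filter (fun q => inIncidence P i q ≠ 0 ∧ outIncidence P j q ≠ 0)

/-- The two arcs `k` and `l` between `i` and `j` can be glued to one parametrized edge carrying a
strictly hyperbolic system. -/
def EdgeCompatible : Prop :=
  ∀ i j k l, k ≠ l → arcs P i j ∪ arcs P j i = {k, l} →
    (((adj P i j, adj P j i) = (2, 0) ∨ (adj P i j, adj P j i) = (0, 2)) →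
      ((k ∈ S.Jplus ∧ l ∈ S.Jplus) ∨ (k ∉ S.Jplus ∧ l ∉ S.Jplus)) ∧
        ∀ x ∈ Icc (0 : ℝ) 1, S.c k x ≠ S.c l x) ∧
    ((adj P i j, adj P j i) = (1, 1) →
      (k ∈ S.Jplus ∧ l ∉ S.Jplus) ∨ (k ∉ S.Jplus ∧ l ∈ S.Jplus))

variable (S)

/-- There is a partition of the sink arcs for which the reconstructed multi digraph can be collapsed
to a graph compatible with the system. -/
def Collapsible : Prop := ∃ P : S.SinkPartition, PairForm P ∧ EdgeCompatible P

/-- The boundary conditions do not split into two systems without common unknown functions. -/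
def Indecomposable : Prop :=
  ∀ T : Finset (Fin (2 * m)),
    (∀ i, (∀ j, S.Xout i j ≠ 0 ∨ S.Xin i j ≠ 0 → j ∈ T) ∨
      (∀ j, S.Xout i j ≠ 0 ∨ S.Xin i j ≠ 0 → j ∉ T)) →
    T = ∅ ∨ T = Finset.univ

end PortHamiltonian

end

/-!
A realization is, up to naming, a way of reading the components as arcs of a directed multigraph and
the boundary conditions as being placed at its vertices. `IsLayout` records this: `tail` and `head`
give the vertices at which a component is outgoing and incoming, `row` the vertex of a condition,
and the requirements on the Kirchhoff conditions become statements about supports. The condition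
that the arcs can be glued in pairs to parametrized edges carrying strictly hyperbolic `2 × 2`
systems is `IsPairing`. Each side of the equivalence is compared with the existence of a layout with
a pairing.

A realization gives a layout and a pairing (`IsRealization.exists_isLayout`). Conversely, in a
pairing the velocities of two partners never coincide on `[0,1]`, so by continuity one of them is the
larger one throughout; it becomes `λ₊`, the other one `λ₋`. The matrices `M j x` may be taken
diagonal, with `F j x = 1`, so that the Riemann invariants are the components themselves and `Phi v`
simply collects the entries of `Xout` and `Xin` (`IsLayout.graphRealizable`).

In a layout, `A p q ≠ 0` means that the arc `q` ends where the arc `p` starts, and the reconstruction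
recovers the layout: its vertices other than sinks are exactly those of the layout
(`IsLayout.start_eq_iff`). At transient vertices the outgoing arcs are a class of equal nonzero rows
of `A`; at sources they are a connected component of the relation "occurs in a common condition",
because this relation never joins different vertices and is connected at each source. Only the sinks
may differ, since sinks fed from different vertices are kept apart, and this does not affect which
arcs are parallel. So the pairing carries over (`IsPairing.transfer`), which yields the conditions.

Conversely, the conditions other than balance and collapsibility, gathered in `IsLocal`, imply
that all outgoing arcs in one boundary condition belong to one vertex of the reconstruction, so
that every arc has exactly one start (`existsUnique_mem_outArcs`) and one end
(`existsUnique_inIncidence`), and every condition one vertex; the balance condition then makes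
this a layout, and the form of the adjacency matrix together with the compatibility of parallel
arcs is the same as a pairing (`isPairing_of_pairForm`, `pairForm_of_isPairing`).

If `Xout` is nonsingular, a permutation with a nonzero term in the Leibniz formula matches the arcs
outgoing from each vertex with its conditions, so the balance condition is automatic. Finally, the
components on the edges of one connected component of the graph share no condition with the others,
which makes an indecomposable system have a connected graph.
-/

noncomputable section

/-! ### Supports of products and irreducible matrices -/

theorem hat_ne_zero {ι κ R : Type*} [Zero R] {A : Matrix ι κ R} {i : ι} {j : κ} :
    hat A i j ≠ 0 ↔ A i j ≠ 0 := by
  by_cases h : A i j = 0 <;> simp [hat, h]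

theorem hat_nonneg {ι κ R : Type*} [Zero R] (A : Matrix ι κ R) (i : ι) (j : κ) :
    0 ≤ hat A i j := by
  by_cases h : A i j = 0 <;> simp [hat, h]

theorem hat_eq_one {ι κ R : Type*} [Zero R] {A : Matrix ι κ R} {i : ι} {j : κ} :
    hat A i j = 1 ↔ A i j ≠ 0 := by
  by_cases h : A i j = 0 <;> simp [hat, h]

theorem hat_transpose_mul_hat_ne_zero {ι κ κ' R : Type*} [Zero R] [Fintype ι]
    {B : Matrix ι κ R} {C : Matrix ι κ' R} {i : κ} {j : κ'} :
    hat ((hat B).transpose * hat C) i j ≠ 0 ↔ ∃ k, B k i ≠ 0 ∧ C k j ≠ 0 := by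
  have h : ((hat B).transpose * hat C) i j = ∑ k, hat B k i * hat C k j := by
    simp [Matrix.mul_apply]
  rw [hat_ne_zero, h, ne_eq, Finset.sum_eq_zero_iff_of_nonneg
    (fun k _ => mul_nonneg (hat_nonneg B k i) (hat_nonneg C k j))]
  push Not
  simp only [Finset.mem_univ, true_and, mul_ne_zero_iff, hat_ne_zero]

/-- For a nonnegative matrix, irreducibility means that any two indices are joined by a nonempty
chain of positive entries. -/
theorem Matrix.isIrreducible_iff_transGen {n R : Type*} [Ring R] [LinearOrder R]
    {A : Matrix n n R} (hA : ∀ i j, 0 ≤ A i j) :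
    A.IsIrreducible ↔ ∀ i j, Relation.TransGen (fun a b => 0 < A a b) i j := by
  let _ : Quiver n := A.toQuiver
  constructor
  · intro h i j
    obtain ⟨p, hp⟩ := h.connected i j
    induction p with
    | nil => simp at hp
    | @cons b c q e ih =>
      cases q with
      | nil => exact .single e.down
      | cons q' e' => exact .tail (ih (by simp)) e.down
  · intro h
    refine ⟨hA, fun i j => ?_⟩
    induction h i j with
    | single e => exact ⟨Quiver.Path.nil.cons ⟨e⟩, by simp⟩
    | tail _ e ih => exact ⟨ih.choose.cons ⟨e⟩, by simp⟩

namespace PortHamiltonian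

variable {m : ℕ} (S : PortHamiltonian m)

/-- Two components are linked if their outgoing values occur in a common boundary condition. -/
def Linked (a b : Fin (2 * m)) : Prop := ∃ i, S.Xout i a ≠ 0 ∧ S.Xout i b ≠ 0

variable {S}

theorem Linked.symm {a b : Fin (2 * m)} (h : S.Linked a b) : S.Linked b a :=
  h.imp fun _ => And.symm

theorem A_ne_zero {p q : Fin (2 * m)} :
    S.A p q ≠ 0 ↔ ∃ k, S.Xout k p ≠ 0 ∧ S.Xin k q ≠ 0 :=
  hat_transpose_mul_hat_ne_zero

theorem A_row_eq_iff {p q : Fin (2 * m)} :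
    S.A p = S.A q ↔ ∀ j, S.A p j ≠ 0 ↔ S.A q j ≠ 0 := by
  refine ⟨fun h j => by rw [h], fun h => funext fun j => ?_⟩
  have h1 := h j
  have key : ∀ p, S.A p j = 0 ∨ S.A p j = 1 := fun p => by
    by_cases h : S.A p j = 0
    · exact .inl h
    · exact .inr (hat_eq_one.2 (hat_ne_zero.1 h))
  rcases key p with hp | hp <;> rcases key q with hq | hq <;> simp_all

theorem sourceConn_ne_zero {a b : {j // j ∈ S.sourceArcs}} :
    S.sourceConn a b ≠ 0 ↔ ∃ k ∈ S.sourceRows, S.Xout k a ≠ 0 ∧ S.Xout k b ≠ 0 := by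
  rw [sourceConn, hat_transpose_mul_hat_ne_zero]
  simp [sourceBlock, and_left_comm]

theorem sourceConn_pos {a b : {j // j ∈ S.sourceArcs}} :
    0 < S.sourceConn a b ↔ S.sourceConn a b ≠ 0 :=
  ⟨fun h => h.ne', fun h => lt_of_le_of_ne (hat_nonneg _ _ _) h.symm⟩

theorem mem_outClass {a j : Fin (2 * m)} : j ∈ S.outClass a ↔ S.A j = S.A a := by
  simp [outClass]

theorem mem_sourceArcs {a : Fin (2 * m)} : a ∈ S.sourceArcs ↔ ∀ j, S.A a j = 0 := by
  simp [sourceArcs]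

theorem mem_sinkArcs {a : Fin (2 * m)} : a ∈ S.sinkArcs ↔ ∀ i, S.A i a = 0 := by
  simp [sinkArcs]

theorem mem_sourceRows {i : Fin (2 * m)} :
    i ∈ S.sourceRows ↔ ∀ j, S.Xout i j ≠ 0 → j ∈ S.sourceArcs := by
  simp [sourceRows]

theorem mem_rowSet {v : S.Vert} {i : Fin (2 * m)} :
    i ∈ S.rowSet v ↔ ∃ s ∈ S.outArcs v, S.Xout i s ≠ 0 := by
  simp [rowSet]

theorem mem_arcsToSinks {v : S.Vert} {j : Fin (2 * m)} :
    j ∈ S.arcsToSinks v ↔ j ∈ S.sinkArcs ∧ ∃ i ∈ S.rowSet v, S.Xout i j ≠ 0 := by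
  simp [arcsToSinks]

/-! ### The vertices of the reconstruction -/

variable (S) in
/-- The conditions on the matrices that make the reconstruction of the vertices possible: no zero
row or column of `Xout`, arcs with a common predecessor have equal rows in `A`, and locality of the
rows without incoming values. -/
structure IsLocal : Prop where
  nz : S.NoZeroRowCol
  row_eq : ∀ p q j, S.A p j ≠ 0 → S.A q j ≠ 0 → S.A p = S.A q
  loc : S.ZeroInRowsLocal

/-- The only property of line digraph matrices that the reconstruction needs: rows with a common
nonzero position belong to arcs with the same tail, so they are equal. -/
theorem row_eq_of_isLineDigraphMatrix {E : Type*} {A : Matrix E E ℤ} (h : IsLineDigraphMatrix A)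
    (p q j : E) (hp : A p j ≠ 0) (hq : A q j ≠ 0) : A p = A q := by
  obtain ⟨n, G, rfl⟩ := h
  have key : ∀ p, G.lineAdj p j ≠ 0 → G.head j = G.tail p := fun p hp => by
    by_contra h
    simp [MultiDigraph.lineAdj, h] at hp
  have := (key p hp).symm.trans (key q hq)
  funext k
  simp [MultiDigraph.lineAdj, this]

theorem mem_transientGroups {G : Finset (Fin (2 * m))} :
    G ∈ S.transientGroups ↔ ∃ a, S.A a ≠ 0 ∧ S.outClass a = G := by
  simp [transientGroups]

theorem mem_outArcs_inr {B : {B // S.IsSourceGroup B}} {q : Fin (2 * m)} :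
    q ∈ S.outArcs (.inr B) ↔ ∃ h : q ∈ S.sourceArcs, ⟨q, h⟩ ∈ B.1 := by
  simp [outArcs]

theorem mem_transientGroup_iff {G : {G // G ∈ S.transientGroups}} {p : Fin (2 * m)} (hp : p ∈ G.1)
    {q : Fin (2 * m)} : q ∈ G.1 ↔ S.A q = S.A p := by
  obtain ⟨G, hG⟩ := G
  obtain ⟨a, -, rfl⟩ := mem_transientGroups.1 hG
  simp only [mem_outClass] at hp ⊢
  rw [hp]

theorem row_ne_zero_of_mem_transientGroup {G : {G // G ∈ S.transientGroups}} {p : Fin (2 * m)}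
    (hp : p ∈ G.1) : S.A p ≠ 0 := by
  obtain ⟨G, hG⟩ := G
  obtain ⟨a, ha, rfl⟩ := mem_transientGroups.1 hG
  rwa [mem_outClass.1 hp]

theorem mem_sourceArcs_iff_row {a : Fin (2 * m)} : a ∈ S.sourceArcs ↔ S.A a = 0 :=
  mem_sourceArcs.trans ⟨fun h => funext h, fun h j => by rw [h]; rfl⟩

theorem outArcs_nonempty (v : S.Vert) : (S.outArcs v).Nonempty := by
  rcases v with ⟨G, hG⟩ | ⟨B, hB⟩
  · obtain ⟨a, -, rfl⟩ := mem_transientGroups.1 hG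
    exact ⟨a, mem_outClass.2 rfl⟩
  · obtain ⟨b, hb⟩ := hB.1
    exact ⟨b, mem_outArcs_inr.2 ⟨b.2, hb⟩⟩

/-- Inside the index set of an irreducible block any two arcs are joined by a chain of links. -/
theorem transGen_linked_of_mem_outArcs_inr {B : {B // S.IsSourceGroup B}} {p q : Fin (2 * m)}
    (hp : p ∈ S.outArcs (.inr B)) (hq : q ∈ S.outArcs (.inr B)) :
    Relation.TransGen S.Linked p q := by
  obtain ⟨hp', hp⟩ := mem_outArcs_inr.1 hp
  obtain ⟨hq', hq⟩ := mem_outArcs_inr.1 hq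
  have h := (Matrix.isIrreducible_iff_transGen (fun _ _ => hat_nonneg _ _ _)).1 B.2.2.1
    ⟨⟨p, hp'⟩, hp⟩ ⟨⟨q, hq'⟩, hq⟩
  refine Relation.TransGen.lift (fun x : {j // j ∈ B.1} => x.1.1) ?_ _ _ h
  intro a b hab
  obtain ⟨k, -, hk⟩ := sourceConn_ne_zero.1 (sourceConn_pos.1 hab)
  exact ⟨k, hk⟩

namespace IsLocal

/-- All the arcs in one boundary condition have the same row in `A`. -/
theorem row_eq_of_linked (h : S.IsLocal) {a b : Fin (2 * m)} (hab : S.Linked a b) :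
    S.A a = S.A b := by
  obtain ⟨i, ha, hb⟩ := hab
  by_cases hi : ∀ j, S.Xin i j = 0
  · obtain ⟨c, hc⟩ := h.loc i hi
    exact (mem_outClass.1 (hc a ha)).trans (mem_outClass.1 (hc b hb)).symm
  · push Not at hi
    obtain ⟨j, hj⟩ := hi
    exact h.row_eq a b j (A_ne_zero.2 ⟨i, ha, hj⟩) (A_ne_zero.2 ⟨i, hb, hj⟩)

theorem mem_sourceRows_of_mem_sourceArcs (h : S.IsLocal) {i a : Fin (2 * m)}
    (ha : a ∈ S.sourceArcs) (hi : S.Xout i a ≠ 0) : i ∈ S.sourceRows :=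
  mem_sourceRows.2 fun _ hj =>
    mem_sourceArcs_iff_row.2 ((h.row_eq_of_linked ⟨i, hj, hi⟩).trans (mem_sourceArcs_iff_row.1 ha))

theorem sourceConn_pos_iff (h : S.IsLocal) {a b : {j // j ∈ S.sourceArcs}} :
    0 < S.sourceConn a b ↔ S.Linked a b := by
  rw [sourceConn_pos, sourceConn_ne_zero]
  exact ⟨fun ⟨k, _, hk⟩ => ⟨k, hk⟩,
    fun ⟨k, hk⟩ => ⟨k, h.mem_sourceRows_of_mem_sourceArcs a.2 hk.1, hk⟩⟩

/-- The outgoing arcs in one boundary condition start at the same vertex of the reconstruction. -/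
theorem mem_outArcs_of_linked (h : S.IsLocal) {a b : Fin (2 * m)} (hab : S.Linked a b)
    {v : S.Vert} (ha : a ∈ S.outArcs v) : b ∈ S.outArcs v := by
  have hr := h.row_eq_of_linked hab
  rcases v with G | B
  · exact (mem_transientGroup_iff ha).2 hr.symm
  · obtain ⟨ha', haB⟩ := mem_outArcs_inr.1 ha
    have hb' : b ∈ S.sourceArcs := by
      rw [mem_sourceArcs_iff_row] at ha' ⊢
      rw [← hr, ha']
    refine mem_outArcs_inr.2 ⟨hb', ?_⟩
    by_contra hb
    exact (h.sourceConn_pos_iff.2 hab).ne' (B.2.2.2 ⟨a, ha'⟩ haB ⟨b, hb'⟩ hb)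

theorem mem_outArcs_of_transGen (h : S.IsLocal) {a b : Fin (2 * m)}
    (hab : Relation.TransGen S.Linked a b) {v : S.Vert} (ha : a ∈ S.outArcs v) :
    b ∈ S.outArcs v := by
  induction hab with
  | single e => exact h.mem_outArcs_of_linked e ha
  | tail _ e ih => exact h.mem_outArcs_of_linked e ih

/-- The arcs that are joined to a given source arc by chains of links form an irreducible block. -/
theorem exists_sourceGroup (h : S.IsLocal) {q : Fin (2 * m)} (hq : q ∈ S.sourceArcs) :
    ∃ B : {B // S.IsSourceGroup B}, q ∈ S.outArcs (.inr B) := by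
  classical
  let B : Finset {j // j ∈ S.sourceArcs} :=
    Finset.univ.filter fun a => Relation.TransGen (fun a b => 0 < S.sourceConn a b) ⟨q, hq⟩ a
  have memB : ∀ a, a ∈ B ↔ Relation.TransGen (fun a b => 0 < S.sourceConn a b) ⟨q, hq⟩ a := by
    simp [B]
  have hsymm : ∀ a b, 0 < S.sourceConn a b → 0 < S.sourceConn b a := fun a b hab =>
    h.sourceConn_pos_iff.2 (h.sourceConn_pos_iff.1 hab).symm
  -- No column of `Xout` is zero, so there are chains of positive length from an arc to itself.
  have hself : ∀ a, 0 < S.sourceConn a a := fun a =>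
    h.sourceConn_pos_iff.2 ((h.nz a.1).1.imp fun _ hi => ⟨hi, hi⟩)
  have hB : S.IsSourceGroup B := by
    refine ⟨⟨⟨q, hq⟩, (memB _).2 (.single (hself _))⟩, ?_, ?_⟩
    · refine (Matrix.isIrreducible_iff_transGen fun _ _ => hat_nonneg _ _ _).2 ?_
      -- Chains starting at an element of `B` stay in `B`.
      have lift : ∀ a (ha : a ∈ B) b (_ : Relation.TransGen (fun a b => 0 < S.sourceConn a b) a b),
          ∃ hb : b ∈ B, Relation.TransGen (fun x y : {j // j ∈ B} => 0 < S.sourceConn x.1 y.1)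
            ⟨a, ha⟩ ⟨b, hb⟩ := by
        intro a ha b hab
        induction hab with
        | single e => exact ⟨(memB _).2 (((memB _).1 ha).tail e), .single e⟩
        | tail _ e ih => exact ⟨(memB _).2 (((memB _).1 ih.1).tail e), ih.2.tail e⟩
      rintro ⟨a, ha⟩ ⟨b, hb⟩
      have hqa : Relation.TransGen (fun a b => 0 < S.sourceConn a b) a ⟨q, hq⟩ := by
        have := ((memB a).1 ha).swap
        exact Relation.TransGen.mono (fun x y hxy => hsymm _ _ hxy) _ _ this
      exact (lift a ha b (hqa.trans ((memB b).1 hb))).2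
    · intro i hi j hj
      by_contra hij
      exact hj ((memB _).2 (((memB _).1 hi).tail (sourceConn_pos.2 hij)))
  exact ⟨⟨B, hB⟩, mem_outArcs_inr.2 ⟨hq, (memB _).2 (.single (hself _))⟩⟩

/-- Every arc starts at exactly one vertex of the reconstruction. -/
theorem existsUnique_mem_outArcs (h : S.IsLocal) (q : Fin (2 * m)) :
    ∃! v : S.Vert, q ∈ S.outArcs v := by
  by_cases hq : S.A q = 0
  · obtain ⟨B, hB⟩ := h.exists_sourceGroup (mem_sourceArcs_iff_row.2 hq)
    refine ⟨.inr B, hB, fun v hv => ?_⟩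
    rcases v with G | B'
    · exact absurd hq (row_ne_zero_of_mem_transientGroup hv)
    · congr 1
      apply Subtype.ext
      have key : ∀ B B' : {B // S.IsSourceGroup B}, q ∈ S.outArcs (.inr B) →
          q ∈ S.outArcs (.inr B') → B.1 ⊆ B'.1 := fun B B' hB hB' x hx =>
        (mem_outArcs_inr.1 (h.mem_outArcs_of_transGen
          (transGen_linked_of_mem_outArcs_inr hB (mem_outArcs_inr.2 ⟨x.2, hx⟩)) hB')).2
      exact (key _ _ hv hB).antisymm (key _ _ hB hv)
  · refine ⟨.inl ⟨S.outClass q, mem_transientGroups.2 ⟨q, hq, rfl⟩⟩, mem_outClass.2 rfl,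
      fun v hv => ?_⟩
    rcases v with G | B
    · congr 1
      apply Subtype.ext
      ext p
      rw [mem_transientGroup_iff hv, mem_outClass]
    · exact absurd (mem_sourceArcs_iff_row.1 (mem_outArcs_inr.1 hv).1) hq

/-- The vertex of the reconstruction at which an arc starts. -/
def start (h : S.IsLocal) (q : Fin (2 * m)) : S.Vert := (h.existsUnique_mem_outArcs q).choose

theorem mem_outArcs_iff (h : S.IsLocal) {q : Fin (2 * m)} {v : S.Vert} :
    q ∈ S.outArcs v ↔ h.start q = v :=
  ⟨fun hq => ((h.existsUnique_mem_outArcs q).choose_spec.2 v hq).symm,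
    fun hq => hq ▸ (h.existsUnique_mem_outArcs q).choose_spec.1⟩

theorem start_eq_of_linked (h : S.IsLocal) {a b : Fin (2 * m)} (hab : S.Linked a b) :
    h.start a = h.start b :=
  (h.mem_outArcs_iff.1 (h.mem_outArcs_of_linked hab (h.mem_outArcs_iff.2 rfl))).symm

/-- A row belongs to the vertex at which any one of the arcs in its support starts. -/
theorem mem_rowSet_iff (h : S.IsLocal) {i q : Fin (2 * m)} (hi : S.Xout i q ≠ 0) {v : S.Vert} :
    i ∈ S.rowSet v ↔ h.start q = v := by
  rw [mem_rowSet]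
  constructor
  · rintro ⟨s, hs, his⟩
    rw [← h.mem_outArcs_iff.1 hs]
    exact h.start_eq_of_linked ⟨i, hi, his⟩
  · exact fun hq => ⟨q, h.mem_outArcs_iff.2 hq, hi⟩

theorem mem_arcsToSinks_iff (h : S.IsLocal) {q : Fin (2 * m)} {v : S.Vert} :
    q ∈ S.arcsToSinks v ↔ q ∈ S.sinkArcs ∧ h.start q = v := by
  rw [mem_arcsToSinks]
  refine and_congr_right fun _ => ⟨fun ⟨i, hi, hiq⟩ => (h.mem_rowSet_iff hiq).1 hi, fun hq => ?_⟩
  obtain ⟨i, hi⟩ := (h.nz q).1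
  exact ⟨i, (h.mem_rowSet_iff hi).2 hq, hi⟩

/-- If `Xout` is nonsingular, a nonzero term of the Leibniz formula for its determinant matches the
arcs outgoing from each vertex with the rows belonging to it. -/
theorem balanced_of_isUnit_det (h : S.IsLocal) (hdet : IsUnit S.Xout.det) : S.Balanced := by
  have h0 := hdet.ne_zero
  rw [Matrix.det_apply] at h0
  obtain ⟨τ, -, hτ⟩ := Finset.exists_ne_zero_of_sum_ne_zero h0
  have hτ' : ∀ j, S.Xout (τ j) j ≠ 0 := fun j hj =>
    hτ (by rw [Finset.prod_eq_zero (f := fun i => S.Xout (τ i) i) (Finset.mem_univ j) hj, smul_zero])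
  intro v
  refine (Finset.card_equiv τ fun j => ?_).symm
  rw [h.mem_rowSet_iff (hτ' j), h.mem_outArcs_iff]

/-- The arc `q` ends at the vertex from which the arc `p` starts if and only if `A p q ≠ 0`; for a
source both sides fail. -/
theorem inIncidence_start_ne_zero (h : S.IsLocal) (P : S.SinkPartition) {p q : Fin (2 * m)} :
    inIncidence P (.inl (h.start p)) q ≠ 0 ↔ S.A p q ≠ 0 := by
  have hp : p ∈ S.outArcs (h.start p) := h.mem_outArcs_iff.2 rfl
  rcases hv : h.start p with G | B
  · rw [hv] at hp
    have : (∃ p' ∈ G.1, S.A p' q ≠ 0) ↔ S.A p q ≠ 0 := by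
      constructor
      · rintro ⟨p', hp', hq⟩
        rwa [(mem_transientGroup_iff hp).1 hp'] at hq
      · exact fun hq => ⟨p, hp, hq⟩
    by_cases hpq : S.A p q ≠ 0 <;> simp_all [inIncidence]
  · rw [hv] at hp
    have := mem_sourceArcs.1 (mem_outArcs_inr.1 hp).1 q
    simp [inIncidence, this]

theorem inIncidence_sink_ne_zero (P : S.SinkPartition) {q : Fin (2 * m)}
    {z : Σ v : S.Vert, {p // p ∈ (P v).parts}} :
    inIncidence P (.inr z) q ≠ 0 ↔ q ∈ z.2.1 := by
  by_cases hq : q ∈ z.2.1 <;> simp [inIncidence, hq]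

theorem exists_start_eq (h : S.IsLocal) (v : S.Vert) : ∃ q, h.start q = v :=
  (outArcs_nonempty v).imp fun _ => h.mem_outArcs_iff.1

/-- Every arc ends at exactly one vertex of the reconstruction. -/
theorem existsUnique_inIncidence (h : S.IsLocal) (P : S.SinkPartition) (q : Fin (2 * m)) :
    ∃! w : FullVert P, inIncidence P w q ≠ 0 := by
  by_cases hq : q ∈ S.sinkArcs
  · have hq' := mem_sinkArcs.1 hq
    obtain ⟨p, hp, hqp⟩ := (P (h.start q)).exists_mem (h.mem_arcsToSinks_iff.2 ⟨hq, rfl⟩)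
    refine ⟨.inr ⟨h.start q, p, hp⟩, (inIncidence_sink_ne_zero P).2 hqp, fun w hw => ?_⟩
    rcases w with v | ⟨v, p', hp'⟩
    · obtain ⟨s, rfl⟩ := h.exists_start_eq v
      exact absurd (hq' s) ((h.inIncidence_start_ne_zero P).1 hw)
    · have hqp' := (inIncidence_sink_ne_zero P).1 hw
      obtain rfl := (h.mem_arcsToSinks_iff.1 ((P v).le hp' hqp')).2
      obtain rfl := (P (h.start q)).eq_of_mem_parts hp hp' hqp hqp'
      rfl
  · rw [mem_sinkArcs] at hq
    push Not at hq
    obtain ⟨s, hs⟩ := hq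
    refine ⟨.inl (h.start s), (h.inIncidence_start_ne_zero P).2 hs, fun w hw => ?_⟩
    rcases w with v | ⟨v, p', hp'⟩
    · obtain ⟨s', rfl⟩ := h.exists_start_eq v
      have hr := h.row_eq _ _ _ ((h.inIncidence_start_ne_zero P).1 hw) hs
      have hs0 : S.A s ≠ 0 := fun h0 => hs (by rw [h0]; rfl)
      have hmem : s' ∈ S.outArcs (h.start s) := by
        have hss : s ∈ S.outArcs (h.start s) := h.mem_outArcs_iff.2 rfl
        rcases hv : h.start s with G | B <;> rw [hv] at hss
        · exact (mem_transientGroup_iff hss).2 hr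
        · exact absurd (mem_sourceArcs_iff_row.1 (mem_outArcs_inr.1 hss).1) hs0
      rw [h.mem_outArcs_iff.1 hmem]
    · have hqp' := (inIncidence_sink_ne_zero P).1 hw
      exact absurd (mem_sinkArcs.1 (h.mem_arcsToSinks_iff.1 ((P v).le hp' hqp')).1 s) hs

/-- The vertex of the reconstruction, including the sinks, at which an arc ends. -/
def finish (h : S.IsLocal) (P : S.SinkPartition) (q : Fin (2 * m)) : FullVert P :=
  (h.existsUnique_inIncidence P q).choose

theorem inIncidence_ne_zero_iff (h : S.IsLocal) (P : S.SinkPartition) {q : Fin (2 * m)}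
    {w : FullVert P} : inIncidence P w q ≠ 0 ↔ h.finish P q = w :=
  ⟨fun hq => ((h.existsUnique_inIncidence P q).choose_spec.2 w hq).symm,
    fun hq => hq ▸ (h.existsUnique_inIncidence P q).choose_spec.1⟩

theorem finish_eq_start_iff (h : S.IsLocal) (P : S.SinkPartition) {p q : Fin (2 * m)} :
    h.finish P q = .inl (h.start p) ↔ S.A p q ≠ 0 := by
  rw [← h.inIncidence_ne_zero_iff, h.inIncidence_start_ne_zero]

theorem finish_eq_sink_iff (h : S.IsLocal) (P : S.SinkPartition) {q : Fin (2 * m)}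
    {z : Σ v : S.Vert, {p // p ∈ (P v).parts}} : h.finish P q = .inr z ↔ q ∈ z.2.1 := by
  rw [← h.inIncidence_ne_zero_iff, inIncidence_sink_ne_zero]

end IsLocal

/-! ### Layouts of the components and pairings of the arcs -/

variable (S) in
/-- The components of `S`, considered as arcs from `tail` to `head`, and the boundary conditions,
the `i`-th of which is placed at `row i`, form a multi digraph with Kirchhoff conditions of the kind
occurring in a realization: at every vertex there are as many conditions as outgoing arcs, they
couple every outgoing to every incoming arc, and at a vertex without incoming arcs they join all the
outgoing arcs by chains of links. -/
structure IsLayout {V : Type*} (tail head row : Fin (2 * m) → V) : Prop where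
  nz : S.NoZeroRowCol
  ne : ∀ q, tail q ≠ head q
  out_supp : ∀ i j, S.Xout i j ≠ 0 → row i = tail j
  in_supp : ∀ i j, S.Xin i j ≠ 0 → row i = head j
  conn : ∀ p q, tail p = head q → S.A p q ≠ 0
  source : ∀ p q, tail p = tail q → (∀ j, head j ≠ tail p) → Relation.TransGen S.Linked p q
  card : ∀ v, Nat.card {i // row i = v} = Nat.card {q // tail q = v}
  touch : ∀ v, ∃ q, tail q = v ∨ head q = v

variable (S) in
/-- The velocity, with its sign, of the component `q` along the parametrized interval. -/
def speed (q : Fin (2 * m)) (x : ℝ) : ℝ :=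
  open Classical in if q ∈ S.Jplus then S.c q x else -S.c q x

variable (S) in
/-- The end of the arc `q` that corresponds to the parameter `0`. -/
def foot {V : Type*} (tail head : Fin (2 * m) → V) (q : Fin (2 * m)) : V :=
  open Classical in if q ∈ S.Jplus then tail q else head q

variable (S) in
/-- Every arc `q` has exactly one partner with the same ends, and the two can be glued to one
parametrized edge: their ends at the parameter `0` agree, and their velocities are distinct. -/
def IsPairing {V : Type*} (tail head : Fin (2 * m) → V) : Prop :=
  ∀ q, ∃ p, p ≠ q ∧ (∀ s, s(tail s, head s) = s(tail q, head q) ↔ s = q ∨ s = p) ∧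
    S.foot tail head p = S.foot tail head q ∧ ∀ x ∈ Icc (0 : ℝ) 1, S.speed p x ≠ S.speed q x

theorem speed_pos_iff {q : Fin (2 * m)} {x : ℝ} (hx : x ∈ Icc (0 : ℝ) 1) :
    0 < S.speed q x ↔ q ∈ S.Jplus := by
  have := S.c_pos q x hx
  by_cases hq : q ∈ S.Jplus <;> simp [speed, hq, this, this.le]

/-- A pairing carries over to arcs with other ends if these have the same parallel and antiparallel
pairs and if coincidences of ends are preserved. -/
theorem IsPairing.transfer {V W : Type*} {tail head : Fin (2 * m) → V}
    {tail' head' : Fin (2 * m) → W} (h : S.IsPairing tail head)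
    (hends : ∀ p q, s(tail' p, head' p) = s(tail' q, head' q) ↔
      s(tail p, head p) = s(tail q, head q))
    (htail : ∀ p q, tail p = tail q → tail' p = tail' q)
    (hhead : ∀ p q, tail p = tail q → head p = head q → head' p = head' q)
    (hcross : ∀ p q, tail p = head q → tail' p = head' q)
    (hne : ∀ p, tail p ≠ head p) : S.IsPairing tail' head' := by
  intro q
  obtain ⟨p, hpq, hp, hf, hs⟩ := h q
  refine ⟨p, hpq, fun s => (hends s q).trans (hp s), ?_, hs⟩
  have hpq' := (hp p).2 (.inr rfl)
  rw [Sym2.eq_iff] at hpq'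
  unfold foot at hf ⊢
  have := hne p
  have := hne q
  split_ifs at hf ⊢ with h1 h2 h2
  · exact htail _ _ hf
  · exact hcross _ _ hf
  · exact (hcross _ _ hf.symm).symm
  · rcases hpq' with ⟨a, b⟩ | ⟨a, b⟩
    · exact hhead _ _ a b
    · exact absurd (a.trans hf.symm) ‹_›

theorem foot_eq_or {V : Type*} (tail head : Fin (2 * m) → V) (q : Fin (2 * m)) :
    (q ∈ S.Jplus ∧ S.foot tail head q = tail q) ∨ (q ∉ S.Jplus ∧ S.foot tail head q = head q) := by
  by_cases hq : q ∈ S.Jplus <;> simp [foot, hq]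

theorem IsPairing.map {V W : Type*} {tail head : Fin (2 * m) → V} (h : S.IsPairing tail head)
    (e : V ≃ W) : S.IsPairing (e ∘ tail) (e ∘ head) := by
  intro q
  obtain ⟨p, hpq, hp, hf, hs⟩ := h q
  refine ⟨p, hpq, fun s => ?_, ?_, hs⟩
  · rw [← hp]
    simp
  · have key : ∀ q, S.foot (e ∘ tail) (e ∘ head) q = e (S.foot tail head q) := fun q => by
      unfold foot
      split_ifs <;> rfl
    rw [key, key, hf]

theorem IsLayout.map {V W : Type*} {tail head row : Fin (2 * m) → V} (h : S.IsLayout tail head row)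
    (e : V ≃ W) : S.IsLayout (e ∘ tail) (e ∘ head) (e ∘ row) where
  nz := h.nz
  ne q := by simpa using h.ne q
  out_supp i j hij := by simpa using h.out_supp i j hij
  in_supp i j hij := by simpa using h.in_supp i j hij
  conn p q hpq := h.conn p q (by simpa using hpq)
  source p q hpq hj := h.source p q (by simpa using hpq) (fun j => by simpa using hj j)
  card v := by simpa [← Equiv.eq_symm_apply] using h.card (e.symm v)
  touch v := by simpa [← Equiv.eq_symm_apply] using h.touch (e.symm v)

/-! ### Pairings of the reconstructed arcs -/

/-- Every entry of the incidence matrices is `0` or `1`, so the entries of their product count arcs. -/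
theorem adj_eq_card (P : S.SinkPartition) (i j : FullVert P) : adj P i j = (arcs P i j).card := by
  classical
  have hin : ∀ q, inIncidence P i q = if inIncidence P i q ≠ 0 then 1 else 0 := fun q => by
    rcases i with (G | B) | z <;> simp only [inIncidence] <;> split_ifs <;> simp_all
  have hout : ∀ q, outIncidence P j q = if outIncidence P j q ≠ 0 then 1 else 0 := fun q => by
    rcases j with v | z <;> simp only [outIncidence] <;> split_ifs <;> simp_all
  have : adj P i j = ∑ q, inIncidence P i q * outIncidence P j q := by
    simp [adj, Matrix.mul_apply]
  rw [this, arcs, Finset.card_filter, Nat.cast_sum]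
  refine Finset.sum_congr rfl fun q _ => ?_
  rw [hin, hout]
  by_cases h1 : inIncidence P i q ≠ 0 <;> by_cases h2 : outIncidence P j q ≠ 0 <;> simp [h1, h2]

namespace IsLocal

variable (h : S.IsLocal) (P : S.SinkPartition)

/-- The tail of an arc among all the vertices of the reconstruction. -/
def origin (q : Fin (2 * m)) : FullVert P := .inl (h.start q)

theorem outIncidence_ne_zero_iff {q : Fin (2 * m)} {w : FullVert P} :
    outIncidence P w q ≠ 0 ↔ h.origin P q = w := by
  rcases w with v | z
  · simp [outIncidence, origin, h.mem_outArcs_iff]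
  · simp [outIncidence, origin]

theorem mem_arcs_iff {i j : FullVert P} {q : Fin (2 * m)} :
    q ∈ arcs P i j ↔ h.finish P q = i ∧ h.origin P q = j := by
  simp only [arcs, Finset.mem_filter, Finset.mem_univ, true_and, h.inIncidence_ne_zero_iff P,
    h.outIncidence_ne_zero_iff P]

theorem mem_arcs_union_iff {i j : FullVert P} {q : Fin (2 * m)} :
    q ∈ arcs P i j ∪ arcs P j i ↔ s(h.origin P q, h.finish P q) = s(i, j) := by
  rw [Finset.mem_union, h.mem_arcs_iff, h.mem_arcs_iff, Sym2.eq_iff]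
  tauto

/-- The adjacency matrix has a zero diagonal, so no arc is a loop, and it leaves exactly one partner
for every arc. Parallel partners must lie on the same side of `Jplus`, opposite ones on different
sides, and in both cases this says that their ends at the parameter `0` agree. -/
theorem isPairing_of_pairForm (hP : PairForm P) (hE : EdgeCompatible P) :
    (∀ q, h.origin P q ≠ h.finish P q) ∧ S.IsPairing (h.origin P) (h.finish P) := by
  classical
  have hne : ∀ q, h.origin P q ≠ h.finish P q := fun q hq => by
    have h0 := hP.1 (h.finish P q)
    rw [adj_eq_card, Nat.cast_eq_zero, Finset.card_eq_zero] at h0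
    have hmem := (h.mem_arcs_iff P).2 ⟨rfl, hq⟩
    rw [h0] at hmem
    exact Finset.notMem_empty q hmem
  refine ⟨hne, fun q => ?_⟩
  set i := h.finish P q with hi
  set j := h.origin P q with hj
  have hdisj : Disjoint (arcs P i j) (arcs P j i) := Finset.disjoint_left.2 fun s hs hs' =>
    hne q (((h.mem_arcs_iff P).1 hs').1.symm.trans ((h.mem_arcs_iff P).1 hs).1)
  have hq : q ∈ arcs P i j := (h.mem_arcs_iff P).2 ⟨rfl, rfl⟩
  have hpos : 0 < (arcs P i j).card := Finset.card_pos.2 ⟨q, hq⟩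
  have hform := hP.2 i j
  have hcard : (arcs P i j ∪ arcs P j i).card = 2 := by
    rw [Finset.card_union_of_disjoint hdisj]
    simp only [adj_eq_card, mem_insert_iff, mem_singleton_iff, Prod.mk.injEq] at hform
    omega
  obtain ⟨p, hpq, hp⟩ : ∃ p, p ≠ q ∧ arcs P i j ∪ arcs P j i = {q, p} := by
    obtain ⟨a, b, hab, hs⟩ := Finset.card_eq_two.1 hcard
    have : q ∈ ({a, b} : Finset _) := hs ▸ Finset.mem_union_left _ hq
    rcases Finset.mem_insert.1 this with rfl | hb
    · exact ⟨b, hab.symm, hs⟩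
    · obtain rfl := Finset.mem_singleton.1 hb
      exact ⟨a, hab, by rw [hs, Finset.pair_comm]⟩
  have hends : ∀ s, s(h.origin P s, h.finish P s) = s(j, i) ↔ s = q ∨ s = p := fun s => by
    rw [Sym2.eq_swap (a := j), ← h.mem_arcs_union_iff, hp]
    simp
  have hcompat := hE i j q p hpq.symm hp
  refine ⟨p, hpq, hends, ?_⟩
  have hpmem := (hends p).2 (.inr rfl)
  rw [Sym2.eq_iff] at hpmem
  have hcp := fun x hx => S.c_pos p x hx
  have hcq := fun x hx => S.c_pos q x hx
  simp only [adj_eq_card, Prod.mk.injEq] at hcompat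
  -- The partner `p` is parallel to `q` in the first case and runs back in the second one.
  rcases hpmem with ⟨h1, h2⟩ | ⟨h1, h2⟩
  · have h2' : (arcs P i j).card = 2 ∧ (arcs P j i).card = 0 := by
      have : ({q, p} : Finset _) ⊆ arcs P i j := by
        intro s hs
        rcases Finset.mem_insert.1 hs with rfl | hs
        · exact hq
        · rw [Finset.mem_singleton.1 hs]
          exact (h.mem_arcs_iff P).2 ⟨h2, h1⟩
      have := Finset.card_le_card this
      rw [Finset.card_pair hpq.symm] at this
      rw [Finset.card_union_of_disjoint hdisj] at hcard
      omega
    have hc := hcompat.1 (.inl (by exact_mod_cast h2'))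
    have hJ : p ∈ S.Jplus ↔ q ∈ S.Jplus := by tauto
    refine ⟨?_, fun x hx => ?_⟩
    · simp [foot, hJ, h1, h2, ← hi, ← hj]
    · have := hc.2 x hx
      by_cases hq : q ∈ S.Jplus <;> simp [speed, hJ, hq, this.symm]
  · have h2' : (arcs P i j).card = 1 ∧ (arcs P j i).card = 1 := by
      have : p ∈ arcs P j i := (h.mem_arcs_iff P).2 ⟨h2, h1⟩
      have := Finset.card_pos.2 ⟨p, this⟩
      rw [Finset.card_union_of_disjoint hdisj] at hcard
      omega
    have hJ := hcompat.2 (by exact_mod_cast h2')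
    have hJ' : p ∈ S.Jplus ↔ q ∉ S.Jplus := by tauto
    refine ⟨?_, fun x hx => ?_⟩
    · by_cases hq : q ∈ S.Jplus <;> simp [foot, hJ', hq, h1, h2, ← hi, ← hj]
    · have := hcp x hx
      have := hcq x hx
      by_cases hq : q ∈ S.Jplus <;> simp only [speed, hJ', hq, if_true, if_false, not_true,
        not_false_eq_true] <;> intro _ <;> linarith

/-- The converse of `isPairing_of_pairForm`. -/
theorem pairForm_of_isPairing (hne : ∀ q, h.origin P q ≠ h.finish P q)
    (hp : S.IsPairing (h.origin P) (h.finish P)) : PairForm P ∧ EdgeCompatible P := by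
  classical
  have hdisj : ∀ i j, i ≠ j → Disjoint (arcs P i j) (arcs P j i) := fun i j hij =>
    Finset.disjoint_left.2 fun s hs hs' =>
      hij (((h.mem_arcs_iff P).1 hs).1.symm.trans ((h.mem_arcs_iff P).1 hs').1)
  have hdiag : ∀ i, arcs P i i = ∅ := fun i => Finset.eq_empty_of_forall_notMem fun q hq =>
    hne q (((h.mem_arcs_iff P).1 hq).2.trans ((h.mem_arcs_iff P).1 hq).1.symm)
  refine ⟨⟨fun i => by simp [adj_eq_card, hdiag], fun i j => ?_⟩, fun i j k l hkl hs => ?_⟩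
  · simp only [adj_eq_card, mem_insert_iff, mem_singleton_iff, Prod.mk.injEq]
    by_cases hij : i = j
    · subst hij
      simp [hdiag]
    rcases (arcs P i j ∪ arcs P j i).eq_empty_or_nonempty with h0 | ⟨q, hq⟩
    · rw [Finset.union_eq_empty] at h0
      simp [h0.1, h0.2]
    · obtain ⟨p, hpq, hends, -⟩ := hp q
      have : arcs P i j ∪ arcs P j i = {q, p} := by
        ext s
        rw [h.mem_arcs_union_iff, ← (h.mem_arcs_union_iff P).1 hq, hends]
        simp
      have hcard := congrArg Finset.card this
      rw [Finset.card_pair hpq.symm, Finset.card_union_of_disjoint (hdisj i j hij)] at hcard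
      norm_cast
      omega
  · have hk : s(h.origin P k, h.finish P k) = s(i, j) :=
      (h.mem_arcs_union_iff P).1 (hs ▸ Finset.mem_insert_self _ _)
    have hl : s(h.origin P l, h.finish P l) = s(i, j) :=
      (h.mem_arcs_union_iff P).1 (hs ▸ Finset.mem_insert_of_mem (Finset.mem_singleton_self _))
    have hij : i ≠ j := fun hij => by
      subst hij
      have := hne k
      rw [Sym2.eq_iff] at hk
      rcases hk with hk | hk <;> exact this (hk.1.trans hk.2.symm)
    obtain ⟨p, hpk, hends, hf, hsp⟩ := hp k
    obtain rfl : l = p := ((hends l).1 (hl.trans hk.symm)).resolve_left hkl.symm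
    have hcard := congrArg Finset.card hs
    rw [Finset.card_pair hkl, Finset.card_union_of_disjoint (hdisj i j hij)] at hcard
    -- Parallel partners with the same end at the parameter `0` flow in the same direction.
    have hsame : h.origin P k = h.origin P l → h.finish P k = h.finish P l →
        ((k ∈ S.Jplus ∧ l ∈ S.Jplus) ∨ (k ∉ S.Jplus ∧ l ∉ S.Jplus)) ∧
        ∀ x ∈ Icc (0 : ℝ) 1, S.c k x ≠ S.c l x := by
      intro ho hfin
      have hJ : (k ∈ S.Jplus ∧ l ∈ S.Jplus) ∨ (k ∉ S.Jplus ∧ l ∉ S.Jplus) := by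
        have := hne k
        have := hne l
        rcases S.foot_eq_or (h.origin P) (h.finish P) k with ⟨a, a'⟩ | ⟨a, a'⟩ <;>
        rcases S.foot_eq_or (h.origin P) (h.finish P) l with ⟨b, b'⟩ | ⟨b, b'⟩
        · exact .inl ⟨a, b⟩
        · exact absurd (ho.symm.trans (a'.symm.trans (hf.symm.trans b'))) ‹_›
        · exact absurd (ho.trans (b'.symm.trans (hf.trans a'))) ‹_›
        · exact .inr ⟨a, b⟩
      refine ⟨hJ, fun x hx hc => hsp x hx ?_⟩
      rcases hJ with ⟨a, b⟩ | ⟨a, b⟩ <;> simp [speed, a, b, hc]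
    have hu : ∀ s, s = k ∨ s = l → s ∈ arcs P i j ∨ s ∈ arcs P j i := fun s hsk => by
      rw [← Finset.mem_union, hs]
      simpa using hsk
    have hkm := hu k (.inl rfl)
    have hlm := hu l (.inr rfl)
    simp only [adj_eq_card, Prod.mk.injEq]
    norm_cast
    constructor
    · rintro (⟨-, h0⟩ | ⟨h0, -⟩)
      · rw [Finset.card_eq_zero] at h0
        simp only [h0, Finset.notMem_empty, or_false, h.mem_arcs_iff] at hkm hlm
        exact hsame (hkm.2.trans hlm.2.symm) (hkm.1.trans hlm.1.symm)
      · rw [Finset.card_eq_zero] at h0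
        simp only [h0, Finset.notMem_empty, false_or, h.mem_arcs_iff] at hkm hlm
        exact hsame (hkm.2.trans hlm.2.symm) (hkm.1.trans hlm.1.symm)
    · rintro ⟨h1, h1'⟩
      have hno : h.origin P k ≠ h.origin P l ∧ h.finish P k ≠ h.finish P l := by
        rcases hkm with hkm | hkm <;> rcases hlm with hlm | hlm
        · exact absurd (Finset.card_le_one.1 h1.le k hkm l hlm) hkl
        · rw [h.mem_arcs_iff] at hkm hlm
          rw [hkm.1, hkm.2, hlm.1, hlm.2]
          exact ⟨hij.symm, hij⟩
        · rw [h.mem_arcs_iff] at hkm hlm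
          rw [hkm.1, hkm.2, hlm.1, hlm.2]
          exact ⟨hij, hij.symm⟩
        · exact absurd (Finset.card_le_one.1 h1'.le k hkm l hlm) hkl
      rcases S.foot_eq_or (h.origin P) (h.finish P) k with ⟨a, a'⟩ | ⟨a, a'⟩ <;>
      rcases S.foot_eq_or (h.origin P) (h.finish P) l with ⟨b, b'⟩ | ⟨b, b'⟩
      · exact absurd (a'.symm.trans (hf.symm.trans b')) hno.1
      · exact .inl ⟨a, b⟩
      · exact .inr ⟨a, b⟩
      · exact absurd (a'.symm.trans (hf.symm.trans b')) hno.2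

end IsLocal

/-! ### From a layout to the conditions on the matrices -/

/-- The arcs running from one vertex to sinks can be partitioned according to their ends with
respect to any given map `head`. -/
theorem exists_sinkPartition {V : Type*} (head : Fin (2 * m) → V) :
    ∃ P : S.SinkPartition, ∀ v, ∀ p ∈ (P v).parts, ∀ a ∈ p, ∀ b,
      b ∈ p ↔ b ∈ S.arcsToSinks v ∧ head a = head b := by
  classical
  refine ⟨fun v => Finpartition.ofSetSetoid (Setoid.ker head) (S.arcsToSinks v),
    fun v p hp a ha b => ?_⟩
  rw [Finpartition.ofSetSetoid_parts] at hp
  obtain ⟨c, -, rfl⟩ := Finset.mem_image.1 hp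
  have hca := (Finset.mem_filter.1 ha).2
  rw [Finset.mem_filter]
  refine and_congr_right fun _ => ?_
  change head c = head b ↔ _
  rw [show head c = head a from hca]

namespace IsLayout

variable {V : Type*} {tail head row : Fin (2 * m) → V}

theorem A_ne_zero_iff (h : S.IsLayout tail head row) {p q : Fin (2 * m)} :
    S.A p q ≠ 0 ↔ tail p = head q := by
  refine ⟨fun hpq => ?_, h.conn p q⟩
  obtain ⟨k, hk, hk'⟩ := A_ne_zero.1 hpq
  exact (h.out_supp _ _ hk).symm.trans (h.in_supp _ _ hk')

theorem row_eq (h : S.IsLayout tail head row) {p q : Fin (2 * m)} (hpq : tail p = tail q) :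
    S.A p = S.A q :=
  A_row_eq_iff.2 fun j => by rw [h.A_ne_zero_iff, h.A_ne_zero_iff, hpq]

theorem isLocal (h : S.IsLayout tail head row) : S.IsLocal where
  nz := h.nz
  row_eq p q j hp hq := h.row_eq ((h.A_ne_zero_iff.1 hp).trans (h.A_ne_zero_iff.1 hq).symm)
  loc i _ := by
    obtain ⟨a, ha⟩ := (h.nz i).2
    exact ⟨a, fun j hj => mem_outClass.2
      (h.row_eq ((h.out_supp _ _ hj).symm.trans (h.out_supp _ _ ha)))⟩

theorem isLineDigraphMatrix {n : ℕ} {tail head row : Fin (2 * m) → Fin n}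
    (h : S.IsLayout tail head row) : IsLineDigraphMatrix S.A := by
  refine ⟨n, ⟨tail, head, h.ne⟩, ?_⟩
  ext p q
  by_cases hpq : head q = tail p
  · have h1 : S.A p q = 1 := hat_eq_one.2 (hat_ne_zero.1 (h.A_ne_zero_iff.2 hpq.symm))
    simpa [MultiDigraph.lineAdj, hpq] using h1
  · simpa [MultiDigraph.lineAdj, hpq] using
      not_not.1 (mt h.A_ne_zero_iff.1 (Ne.symm hpq))

/-- The vertices of the reconstruction that are not sinks are those of the layout. -/
theorem start_eq_iff (h : S.IsLayout tail head row) {p q : Fin (2 * m)} :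
    h.isLocal.start p = h.isLocal.start q ↔ tail p = tail q := by
  constructor
  · intro hpq
    have hq := h.isLocal.mem_outArcs_iff.2 (rfl : h.isLocal.start q = _)
    have hp := h.isLocal.mem_outArcs_iff.2 hpq
    rcases hv : h.isLocal.start q with G | B <;> rw [hv] at hp hq
    · have hne := row_ne_zero_of_mem_transientGroup hp
      obtain ⟨j, hj⟩ := Function.ne_iff.1 hne
      have hj' : S.A q j ≠ 0 := (mem_transientGroup_iff hp).1 hq ▸ hj
      exact (h.A_ne_zero_iff.1 hj).trans (h.A_ne_zero_iff.1 hj').symm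
    · have hchain := transGen_linked_of_mem_outArcs_inr hp hq
      clear hpq hp hq hv
      induction hchain with
      | single e =>
        obtain ⟨k, h1, h2⟩ := e
        exact (h.out_supp _ _ h1).symm.trans (h.out_supp _ _ h2)
      | tail _ e ih =>
        obtain ⟨k, h1, h2⟩ := e
        exact ih.trans ((h.out_supp _ _ h1).symm.trans (h.out_supp _ _ h2))
  · intro hpq
    by_cases hj : ∃ j, head j = tail p
    · obtain ⟨j, hj⟩ := hj
      -- The end of `j` does not depend on the partition here, as `j` does not run to a sink.
      have h1 := (h.isLocal.finish_eq_start_iff (fun _ => ⊥)).2 (h.A_ne_zero_iff.2 hj.symm)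
      have h2 := (h.isLocal.finish_eq_start_iff (fun _ => ⊥)).2
        (h.A_ne_zero_iff.2 (hpq.symm.trans hj.symm))
      exact Sum.inl.inj (h1.symm.trans h2)
    · push Not at hj
      exact (h.isLocal.mem_outArcs_iff.1 (h.isLocal.mem_outArcs_of_transGen (h.source p q hpq hj)
        (h.isLocal.mem_outArcs_iff.2 rfl))).symm

theorem balanced (h : S.IsLayout tail head row) : S.Balanced := by
  intro v
  obtain ⟨q, rfl⟩ := h.isLocal.exists_start_eq v
  have hcard := h.card (tail q)
  rwa [Nat.subtype_card (S.rowSet (h.isLocal.start q)) fun i => by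
      obtain ⟨k, hk⟩ := (h.nz i).2
      rw [h.isLocal.mem_rowSet_iff hk, h.start_eq_iff, h.out_supp i k hk],
    Nat.subtype_card (S.outArcs (h.isLocal.start q)) fun p => by
      rw [h.isLocal.mem_outArcs_iff, h.start_eq_iff]] at hcard

/-- The sinks of the reconstruction may be finer than those of the layout, since arcs from different
vertices never share a sink, but arcs with both ends equal stay parallel. -/
theorem collapsible (h : S.IsLayout tail head row) (hp : S.IsPairing tail head) :
    S.Collapsible := by
  obtain ⟨P, hP⟩ := S.exists_sinkPartition head
  have hL := h.isLocal
  have htail : ∀ p q, hL.origin P p = hL.origin P q ↔ tail p = tail q := fun p q =>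
    Sum.inl_injective.eq_iff.trans h.start_eq_iff
  have hcross : ∀ p q, hL.origin P p = hL.finish P q ↔ tail p = head q := fun p q => by
    rw [eq_comm, IsLocal.origin, hL.finish_eq_start_iff, h.A_ne_zero_iff]
  have hhead : ∀ p q, hL.finish P p = hL.finish P q → head p = head q := by
    intro p q hpq
    rcases hw : hL.finish P q with v | z
    · obtain ⟨s, rfl⟩ := hL.exists_start_eq v
      exact ((hcross s p).1 (hpq.trans hw).symm).symm.trans ((hcross s q).1 hw.symm)
    · have hpz := (hL.finish_eq_sink_iff P).1 (hpq.trans hw)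
      have hqz := (hL.finish_eq_sink_iff P).1 hw
      exact ((hP _ _ z.2.2 p hpz q).1 hqz).2
  have hhead' : ∀ p q, tail p = tail q → head p = head q → hL.finish P p = hL.finish P q := by
    intro p q ht hh
    rcases hw : hL.finish P p with v | z
    · obtain ⟨s, rfl⟩ := hL.exists_start_eq v
      exact (hcross s q).2 (((hcross s p).1 hw.symm).trans hh)
    · have hpz := (hL.finish_eq_sink_iff P).1 hw
      have hp' := hL.mem_arcsToSinks_iff.1 ((P z.1).le z.2.2 hpz)
      refine ((hL.finish_eq_sink_iff P).2 ((hP _ _ z.2.2 p hpz q).2 ⟨?_, hh⟩)).symm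
      refine hL.mem_arcsToSinks_iff.2 ⟨mem_sinkArcs.2 fun s => ?_, ?_⟩
      · have := mem_sinkArcs.1 hp'.1 s
        by_contra hs
        exact h.A_ne_zero_iff.2 ((h.A_ne_zero_iff.1 hs).trans hh.symm) this
      · rw [← hp'.2, h.start_eq_iff, ht]
  refine ⟨P, hL.pairForm_of_isPairing P (fun q hq => h.ne q ((hcross q q).1 hq))
    (hp.transfer (fun p q => ?_) (fun p q => (htail p q).2) hhead' (fun p q => (hcross p q).2)
      h.ne)⟩
  rw [Sym2.eq_iff, Sym2.eq_iff, htail, hcross, eq_comm (a := hL.finish P p) (b := hL.origin P q),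
    hcross, eq_comm (a := tail q) (b := head p)]
  exact or_congr_left ⟨fun ⟨a, b⟩ => ⟨a, hhead p q b⟩, fun ⟨a, b⟩ => ⟨a, hhead' p q a b⟩⟩

end IsLayout

/-! ### From the conditions on the matrices to a layout -/

namespace IsLocal

variable (h : S.IsLocal) (P : S.SinkPartition)

/-- The vertex of the reconstruction to which a boundary condition belongs. -/
def rowVertex (i : Fin (2 * m)) : FullVert P := h.origin P (h.nz i).2.choose

theorem rowVertex_eq {i q : Fin (2 * m)} (hi : S.Xout i q ≠ 0) :
    h.rowVertex P i = h.origin P q :=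
  congrArg Sum.inl (h.start_eq_of_linked ⟨i, (h.nz i).2.choose_spec, hi⟩)

theorem isLayout (hne : ∀ q, h.origin P q ≠ h.finish P q) (hbal : S.Balanced) :
    S.IsLayout (h.origin P) (h.finish P) (h.rowVertex P) where
  nz := h.nz
  ne := hne
  out_supp i j hij := h.rowVertex_eq P hij
  in_supp i j hij :=
    ((h.finish_eq_start_iff P).2 (A_ne_zero.2 ⟨i, (h.nz i).2.choose_spec, hij⟩)).symm
  conn p q hpq := (h.finish_eq_start_iff P).1 hpq.symm
  source p q hpq hj := by
    have hp := h.mem_outArcs_iff.2 (rfl : h.start p = _)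
    have hq := h.mem_outArcs_iff.2 (Sum.inl.inj hpq).symm
    rcases hv : h.start p with G | B <;> rw [hv] at hp hq
    · obtain ⟨j, hjp⟩ := Function.ne_iff.1 (row_ne_zero_of_mem_transientGroup hp)
      exact absurd ((h.finish_eq_start_iff P).2 hjp) (hj j)
    · exact transGen_linked_of_mem_outArcs_inr hp hq
  card v := by
    rcases v with w | z
    · rw [Nat.subtype_card (S.rowSet w) fun i => by
          obtain ⟨k, hk⟩ := (h.nz i).2
          rw [h.mem_rowSet_iff hk, h.rowVertex_eq P hk, origin, Sum.inl.injEq],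
        Nat.subtype_card (S.outArcs w) fun p => by
          rw [h.mem_outArcs_iff, origin, Sum.inl.injEq]]
      exact hbal w
    · simp [rowVertex, origin]
  touch v := by
    rcases v with w | z
    · exact (h.exists_start_eq w).imp fun q hq => .inl (congrArg Sum.inl hq)
    · obtain ⟨q, hq⟩ := (P z.1).nonempty_of_mem_parts z.2.2
      exact ⟨q, .inr ((h.finish_eq_sink_iff P).2 hq)⟩

theorem exists_isLayout (h : S.IsLocal) (hbal : S.Balanced) (hc : S.Collapsible) :
    ∃ (n : ℕ) (tail head row : Fin (2 * m) → Fin n),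
      S.IsLayout tail head row ∧ S.IsPairing tail head := by
  obtain ⟨P, hP, hE⟩ := hc
  obtain ⟨hne, hpair⟩ := h.isPairing_of_pairForm P hP hE
  have e := Finite.equivFin (FullVert P)
  exact ⟨_, _, _, _, (h.isLayout P hne hbal).map e, hpair.map e⟩

end IsLocal

end PortHamiltonian

/-! ### The arcs of a network -/

namespace Network

variable {r m : ℕ} (N : Network r m)

/-- The vertex at which the value of the Riemann invariant `a` is outgoing. -/
def origin (a : Fin 2 × Fin m) : Fin r :=
  open Classical in if N.Pos a then N.tail a.2 else N.head a.2

/-- The vertex at which the value of the Riemann invariant `a` is incoming. -/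
def target (a : Fin 2 × Fin m) : Fin r :=
  open Classical in if N.Pos a then N.head a.2 else N.tail a.2

variable {N}

theorem isOut_iff {v : Fin r} {a : Fin 2 × Fin m} : N.IsOut v a ↔ N.origin a = v := by
  by_cases h : N.Pos a <;> simp [IsOut, origin, h]

theorem isIn_iff {v : Fin r} {a : Fin 2 × Fin m} : N.IsIn v a ↔ N.target a = v := by
  by_cases h : N.Pos a <;> simp [IsIn, target, h]

theorem mk_origin_target (a : Fin 2 × Fin m) : s(N.origin a, N.target a) = N.edge a.2 := by
  rw [N.edge_eq]
  by_cases h : N.Pos a <;> simp [origin, target, h, Sym2.eq_swap]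

theorem adj_origin_target (a : Fin 2 × Fin m) : N.graph.Adj (N.origin a) (N.target a) := by
  rw [← SimpleGraph.mem_edgeSet, mk_origin_target]
  exact (N.edge a.2).2

theorem tail_ne_head (j : Fin m) : N.tail j ≠ N.head j := by
  have : N.graph.Adj (N.tail j) (N.head j) := by
    rw [← SimpleGraph.mem_edgeSet, ← N.edge_eq]
    exact (N.edge j).2
  exact this.ne

/-- As the graph is simple, two Riemann invariants have the same ends only if they live on the same
edge. -/
theorem mk_origin_target_eq_iff {a b : Fin 2 × Fin m} :
    s(N.origin a, N.target a) = s(N.origin b, N.target b) ↔ a.2 = b.2 := by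
  rw [mk_origin_target, mk_origin_target, Subtype.coe_inj, N.edge.apply_eq_iff_eq]

theorem alpha_eq_two_iff {j : Fin m} : N.alpha j = 2 ↔ ∀ k, N.Pos (k, j) := by
  classical
  have h : N.alpha j = 2 ↔ N.alpha j = Fintype.card (Fin 2) := by rw [Fintype.card_fin]
  rw [h, alpha, Nat.card_eq_fintype_card, Fintype.card_subtype, Finset.card_eq_iff_eq_univ]
  simp [Finset.ext_iff]

theorem alpha_eq_zero_iff {j : Fin m} : N.alpha j = 0 ↔ ∀ k, ¬ N.Pos (k, j) := by
  classical
  rw [alpha, Nat.card_eq_fintype_card, Fintype.card_subtype, Finset.card_eq_zero]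
  simp [Finset.ext_iff]

theorem isSink_iff {v : Fin r} : N.IsSink v ↔ ∀ a, N.origin a ≠ v := by
  simp only [IsSink, alpha_eq_two_iff, alpha_eq_zero_iff]
  constructor
  · rintro h ⟨k, j⟩ ha
    have hne := N.tail_ne_head j
    rcases h j (isOut_iff.2 ha).incident with ⟨h1, h2⟩ | ⟨h1, h2⟩ <;>
      simp only [origin, h1 k, if_true, if_false] at ha
    · exact hne (ha.trans h2.symm)
    · exact hne (h2.trans ha.symm)
  · rintro h j (hj | hj)
    · refine .inr ⟨fun k hk => h (k, j) ?_, hj⟩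
      simp [origin, hk, hj]
    · refine .inl ⟨fun k => ?_, hj⟩
      by_contra hk
      exact h (k, j) (by simp [origin, hk, hj])

theorem isSource_iff {v : Fin r} : N.IsSource v ↔ ∀ a, N.target a ≠ v := by
  simp only [IsSource, alpha_eq_two_iff, alpha_eq_zero_iff]
  constructor
  · rintro h ⟨k, j⟩ ha
    have hne := N.tail_ne_head j
    rcases h j (isIn_iff.2 ha).incident with ⟨h1, h2⟩ | ⟨h1, h2⟩ <;>
      simp only [target, h1 k, if_true, if_false] at ha
    · exact hne (ha.trans h2.symm)
    · exact hne (h2.trans ha.symm)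
  · rintro h j (hj | hj)
    · refine .inr ⟨fun k => ?_, hj⟩
      by_contra hk
      exact h (k, j) (by simp [target, hk, hj])
    · refine .inl ⟨fun k hk => h (k, j) ?_, hj⟩
      simp [target, hk, hj]

variable (Phi : N.Kirchhoff)

theorem globalOut_of_isOut {v : Fin r} {s : Fin (N.numOut v)} {a : Fin 2 × Fin m}
    (h : N.IsOut v a) : globalOut Phi ⟨v, s⟩ a = psiOut Phi v s ⟨a, h⟩ := by
  simp [globalOut, h]

theorem globalIn_of_isIn {v : Fin r} {s : Fin (N.numOut v)} {a : Fin 2 × Fin m}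
    (h : N.IsIn v a) : globalIn Phi ⟨v, s⟩ a = psiIn Phi v s ⟨a, h⟩ := by
  simp [globalIn, h]

theorem isOut_of_globalOut_ne_zero {s : Σ v : Fin r, Fin (N.numOut v)} {a : Fin 2 × Fin m}
    (h : globalOut Phi s a ≠ 0) : N.IsOut s.1 a := by
  by_contra hn
  exact h (by simp [globalOut, hn])

theorem isIn_of_globalIn_ne_zero {s : Σ v : Fin r, Fin (N.numOut v)} {a : Fin 2 × Fin m}
    (h : globalIn Phi s a ≠ 0) : N.IsIn s.1 a := by
  by_contra hn
  exact h (by simp [globalIn, hn])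

theorem transientConn_eq_one_iff {v : Fin r} {l : {a // N.IsOut v a}} {j : {a // N.IsIn v a}} :
    transientConn Phi v l j = 1 ↔ ∃ s, psiIn Phi v s j ≠ 0 ∧ psiOut Phi v s l ≠ 0 := by
  unfold transientConn
  split_ifs with h <;> simp [h]

theorem sourceConn_pos_iff {v : Fin r} {a b : {a // N.IsOut v a}} :
    0 < sourceConn Phi v a b ↔ ∃ s, psiOut Phi v s a ≠ 0 ∧ psiOut Phi v s b ≠ 0 := by
  unfold sourceConn
  split_ifs with h <;> simp [h]

theorem sourceConn_nonneg {v : Fin r} (a b : {a // N.IsOut v a}) : 0 ≤ sourceConn Phi v a b := by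
  unfold sourceConn
  split_ifs <;> simp

end Network

namespace PortHamiltonian

variable {m : ℕ} {S : PortHamiltonian m}

open Network

/-! ### From a realization to a layout -/

/-- A realization is a layout in which the two Riemann invariants on each edge are partners. -/
theorem IsRealization.exists_isLayout {r : ℕ} {N : Network r m} {Phi : N.Kirchhoff}
    (h : S.IsRealization N Phi) :
    ∃ (σ : Fin (2 * m) ≃ Fin 2 × Fin m) (row : Fin (2 * m) → Fin r),
      S.IsLayout (N.origin ∘ σ) (N.target ∘ σ) row ∧
        S.IsPairing (N.origin ∘ σ) (N.target ∘ σ) := by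
  obtain ⟨⟨ρ, σ, hpos, hneg, hout, hin⟩, hnz, htrans, hsource⟩ := h
  have hout' : ∀ i j, S.Xout i j = globalOut Phi (ρ i) (σ j) := fun i j => by rw [hout]; rfl
  have hin' : ∀ i j, S.Xin i j = globalIn Phi (ρ i) (σ j) := fun i j => by rw [hin]; rfl
  have hPos : ∀ q, N.Pos (σ q) ↔ q ∈ S.Jplus := fun q => by
    constructor
    · intro hq
      by_contra hJ
      have h0 := hq 0 (by simp)
      rw [hneg q hJ 0 (by simp)] at h0
      have := S.c_pos q 0 (by simp)
      linarith
    · intro hJ x hx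
      rw [hpos q hJ x hx]
      exact S.c_pos q x hx
  have hspeed : ∀ q, ∀ x ∈ Icc (0 : ℝ) 1, S.speed q x = N.lam (σ q).2 (σ q).1 x := by
    intro q x hx
    by_cases hJ : q ∈ S.Jplus
    · simp [speed, hJ, hpos q hJ x hx]
    · simp [speed, hJ, hneg q hJ x hx]
  have hfoot : ∀ q, S.foot (N.origin ∘ σ) (N.target ∘ σ) q = N.tail (σ q).2 := by
    intro q
    by_cases hJ : q ∈ S.Jplus
    · simp [foot, hJ, Network.origin, (hPos q).2 hJ]
    · simp [foot, hJ, Network.target, mt (hPos q).1 hJ]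
  have hout_supp : ∀ i j, S.Xout i j ≠ 0 → (ρ i).1 = N.origin (σ j) := fun i j hij =>
    (isOut_iff.1 (isOut_of_globalOut_ne_zero Phi (hout' i j ▸ hij))).symm
  have hsink : ∀ q, ¬ N.IsSink (N.origin (σ q)) := fun q hq => isSink_iff.1 hq (σ q) rfl
  refine ⟨σ, fun i => (ρ i).1, ?_, ?_⟩
  · refine
      { nz := fun j => ⟨?_, ?_⟩
        ne := fun q => (N.adj_origin_target (σ q)).ne
        out_supp := hout_supp
        in_supp := fun i j hij =>
          (isIn_iff.1 (isIn_of_globalIn_ne_zero Phi (hin' i j ▸ hij))).symm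
        conn := fun p q hpq => ?_
        source := fun p q hpq hj => ?_
        card := fun v => ?_
        touch := fun v => ?_ }
    · obtain ⟨s, hs⟩ := (hnz _ (hsink j)).2 ⟨σ j, isOut_iff.2 rfl⟩
      refine ⟨ρ.symm ⟨_, s⟩, ?_⟩
      rwa [hout', ρ.apply_symm_apply, globalOut_of_isOut]
    -- A vertex with a condition has an outgoing value, since there are none of either at a sink.
    · have hv : ¬ N.IsSink (ρ j).1 := fun hv => by
        have : IsEmpty {a : Fin 2 × Fin m // N.IsOut (ρ j).1 a} :=
          ⟨fun a => isSink_iff.1 hv a.1 (isOut_iff.1 a.2)⟩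
        have h0 : N.numOut (ρ j).1 = 0 := Nat.card_of_isEmpty
        exact (Fin.cast h0 (ρ j).2).elim0
      obtain ⟨a, ha⟩ := (hnz _ hv).1 (ρ j).2
      refine ⟨σ.symm a.1, ?_⟩
      rw [hout', σ.apply_symm_apply]
      exact (globalOut_of_isOut Phi a.2).trans_ne ha
    · have hT : N.IsTransient (N.origin (σ p)) :=
        ⟨fun hs => isSource_iff.1 hs (σ q) hpq.symm, hsink p⟩
      have h1 := congrFun (congrFun (htrans _ hT) ⟨σ p, isOut_iff.2 rfl⟩)
        ⟨σ q, isIn_iff.2 hpq.symm⟩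
      unfold transientConn at h1
      obtain ⟨s, hs, hs'⟩ := (transientConn_eq_one_iff Phi).1 h1
      refine A_ne_zero.2 ⟨ρ.symm ⟨_, s⟩, ?_, ?_⟩
      · rwa [hout', ρ.apply_symm_apply, globalOut_of_isOut]
      · rwa [hin', ρ.apply_symm_apply, globalIn_of_isIn]
    · have hS : N.IsSource (N.origin (σ p)) := isSource_iff.2 fun a => by
        simpa using hj (σ.symm a)
      have h1 := (Matrix.isIrreducible_iff_transGen (sourceConn_nonneg Phi)).1 (hsource _ hS)
        ⟨σ p, isOut_iff.2 rfl⟩ ⟨σ q, isOut_iff.2 hpq.symm⟩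
      have h2 := Relation.TransGen.lift (p := S.Linked)
        (fun a : {a // N.IsOut (N.origin (σ p)) a} => σ.symm a.1) ?_ _ _ h1
      · simpa [Function.onFun] using h2
      · intro a b hab
        obtain ⟨s, ha, hb⟩ := (sourceConn_pos_iff Phi).1 hab
        refine ⟨ρ.symm ⟨_, s⟩, ?_, ?_⟩
        · rwa [hout', ρ.apply_symm_apply, σ.apply_symm_apply, globalOut_of_isOut]
        · rwa [hout', ρ.apply_symm_apply, σ.apply_symm_apply, globalOut_of_isOut]
    · calc Nat.card {i // (ρ i).1 = v}
          = Nat.card {s : Σ v : Fin r, Fin (N.numOut v) // s.1 = v} :=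
            Nat.card_congr (ρ.subtypeEquiv fun _ => Iff.rfl)
        _ = Nat.card (Fin (N.numOut v)) := Nat.card_congr (Equiv.sigmaSubtype v)
        _ = Nat.card {a : Fin 2 × Fin m // N.IsOut v a} := Nat.card_fin _
        _ = Nat.card {q // N.origin (σ q) = v} :=
            (Nat.card_congr (σ.subtypeEquiv fun _ => isOut_iff.symm)).symm
    · obtain ⟨j, hj⟩ := N.no_isolated v
      refine ⟨σ.symm (0, j), ?_⟩
      by_cases hp : N.Pos (0, j)
      · simpa [Network.origin, Network.target, hp] using hj
      · simpa [Network.origin, Network.target, hp] using hj.symm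
  · intro q
    have hrev : ∀ k l : Fin 2, k ≠ l → ∀ k', k' = l ∨ k' = k := by decide
    obtain ⟨l, hl⟩ : ∃ l, l ≠ (σ q).1 := exists_ne _
    have hne : ∀ x ∈ Icc (0 : ℝ) 1, ∀ k l, k ≠ l → N.lam (σ q).2 k x ≠ N.lam (σ q).2 l x := by
      intro x hx k l hkl
      have := N.hyperbolic (σ q).2 x hx
      rcases hrev 0 1 (by decide) k with rfl | rfl <;>
        rcases hrev 0 1 (by decide) l with rfl | rfl
      · exact absurd rfl hkl
      · exact this.ne
      · exact this.ne'
      · exact absurd rfl hkl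
    refine ⟨σ.symm (l, (σ q).2), ?_, fun s => ?_, ?_, fun x hx => ?_⟩
    · intro hq
      rw [Equiv.symm_apply_eq] at hq
      exact hl (congrArg Prod.fst hq)
    · simp only [Function.comp_apply]
      rw [mk_origin_target_eq_iff]
      constructor
      · intro hs
        rcases hrev l (σ q).1 hl (σ s).1 with h1 | h1
        · exact .inl (σ.injective (Prod.ext h1 hs))
        · exact .inr (σ.injective (by rw [σ.apply_symm_apply]; exact Prod.ext h1 hs))
      · rintro (rfl | rfl)
        · rfl
        · rw [σ.apply_symm_apply]
    · rw [hfoot, hfoot, σ.apply_symm_apply]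
    · rw [hspeed _ _ hx, hspeed _ _ hx, σ.apply_symm_apply]
      exact hne x hx _ _ hl

/-- The components on the edges of one connected component of the graph occur in boundary conditions
of their own. -/
theorem IsRealization.connected {r : ℕ} {N : Network r m} {Phi : N.Kirchhoff}
    (h : S.IsRealization N Phi) (hm : 0 < m) (hS : S.Indecomposable) : N.graph.Connected := by
  classical
  obtain ⟨σ, row, hL, -⟩ := h.exists_isLayout
  have hadj : ∀ q, N.graph.Reachable (N.origin (σ q)) (N.target (σ q)) := fun q =>
    (N.adj_origin_target (σ q)).reachable
  let q₀ : Fin (2 * m) := ⟨0, by omega⟩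
  let T : Finset (Fin (2 * m)) :=
    Finset.univ.filter fun q => N.graph.Reachable (N.origin (σ q₀)) (N.origin (σ q))
  have hT : ∀ q, q ∈ T ↔ N.graph.Reachable (N.origin (σ q₀)) (N.origin (σ q)) := by simp [T]
  have hrow : ∀ i j, S.Xout i j ≠ 0 ∨ S.Xin i j ≠ 0 →
      N.graph.Reachable (row i) (N.origin (σ j)) := by
    rintro i j (hij | hij)
    · exact hL.out_supp i j hij ▸ SimpleGraph.Reachable.refl _
    · exact hL.in_supp i j hij ▸ (hadj j).symm
  have huniv : T = Finset.univ := by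
    refine (hS T fun i => ?_).resolve_left (Finset.ne_empty_of_mem ((hT q₀).2 (.refl _)))
    by_cases hi : N.graph.Reachable (N.origin (σ q₀)) (row i)
    · exact .inl fun j hj => (hT j).2 (hi.trans (hrow i j hj))
    · exact .inr fun j hj hjT => hi (((hT j).1 hjT).trans (hrow i j hj).symm)
  have hreach : ∀ v, N.graph.Reachable (N.origin (σ q₀)) v := by
    intro v
    obtain ⟨q, hq⟩ := hL.touch v
    have hqT := (hT q).1 (huniv ▸ Finset.mem_univ q)
    rcases hq with rfl | rfl
    · exact hqT
    · exact hqT.trans (hadj q)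
  have : Nonempty (Fin r) := ⟨N.origin (σ q₀)⟩
  exact ⟨fun v w => (hreach v).symm.trans (hreach w)⟩

/-! ### The network built from a layout -/

theorem continuousOn_speed (q : Fin (2 * m)) : ContinuousOn (S.speed q) (Icc 0 1) := by
  by_cases hq : q ∈ S.Jplus
  · have : S.speed q = S.c q := funext fun x => by simp [speed, hq]
    rw [this]
    exact S.c_cont q
  · have : S.speed q = fun x => -S.c q x := funext fun x => by simp [speed, hq]
    rw [this]
    exact (S.c_cont q).neg

/-- Velocities that are distinct everywhere on `[0,1]` are in the same order everywhere. -/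
theorem speed_lt_or_lt {p q : Fin (2 * m)} (h : ∀ x ∈ Icc (0 : ℝ) 1, S.speed p x ≠ S.speed q x) :
    (∀ x ∈ Icc (0 : ℝ) 1, S.speed p x < S.speed q x) ∨
      ∀ x ∈ Icc (0 : ℝ) 1, S.speed q x < S.speed p x := by
  by_contra! hn
  obtain ⟨⟨x, hx, hxl⟩, y, hy, hyl⟩ := hn
  obtain ⟨z, hz, he⟩ := isPreconnected_Icc.intermediate_value₂ hx hy (continuousOn_speed q)
    (continuousOn_speed p) hxl hyl
  exact h z hz he.symm

/-- The other end of the arc `q`, which corresponds to the parameter `1`. -/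
def tip (S : PortHamiltonian m) {V : Type*} (tail head : Fin (2 * m) → V) (q : Fin (2 * m)) : V :=
  open Classical in if q ∈ S.Jplus then head q else tail q

theorem mk_foot_tip {V : Type*} (tail head : Fin (2 * m) → V) (q : Fin (2 * m)) :
    s(S.foot tail head q, S.tip tail head q) = s(tail q, head q) := by
  by_cases hq : q ∈ S.Jplus <;> simp [foot, tip, hq, Sym2.eq_swap]

/-- The pairs of a pairing can be numbered, with the faster component of each pair coming first. -/
theorem IsPairing.exists_numbering {V : Type*} {tail head : Fin (2 * m) → V}
    (h : S.IsPairing tail head) :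
    ∃ τ : Fin 2 × Fin m ≃ Fin (2 * m),
      (∀ j, ∀ x ∈ Icc (0 : ℝ) 1, S.speed (τ (1, j)) x < S.speed (τ (0, j)) x) ∧
      (∀ a b, s(tail (τ a), head (τ a)) = s(tail (τ b), head (τ b)) ↔ a.2 = b.2) ∧
      ∀ a b, a.2 = b.2 → S.foot tail head (τ a) = S.foot tail head (τ b) := by
  classical
  choose mate hne hends hfoot hspeed using h
  have hmm : ∀ q, mate (mate q) = q := fun q => by
    have h1 := (hends q (mate q)).2 (.inr rfl)
    exact (((hends (mate q) q).1 h1.symm).resolve_left (hne q).symm).symm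
  -- `U` consists of the faster component of each pair; it contains half of all the components.
  let U := {q : Fin (2 * m) // ∀ x ∈ Icc (0 : ℝ) 1, S.speed (mate q) x < S.speed q x}
  have hU : ∀ u : U, ¬ ∀ x ∈ Icc (0 : ℝ) 1, S.speed (mate (mate u)) x < S.speed (mate u) x := by
    intro u hu
    have h1 := hu 0 (by simp)
    rw [hmm] at h1
    exact lt_asymm h1 (u.2 0 (by simp))
  let f : Fin 2 × U → Fin (2 * m) := fun a => if a.1 = 0 then a.2.1 else mate a.2.1
  have hf0 : ∀ u : U, f (0, u) = u.1 := fun u => rfl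
  have hf1 : ∀ u : U, f (1, u) = mate u.1 := fun u => rfl
  have hfin2 : ∀ k : Fin 2, k = 0 ∨ k = 1 := by decide
  have hfm : ∀ a, f a = a.2.1 ∨ f a = mate a.2.1 := by
    rintro ⟨k, u⟩
    rcases hfin2 k with rfl | rfl
    · exact .inl (hf0 u)
    · exact .inr (hf1 u)
  have hf : Function.Bijective f := by
    constructor
    · rintro ⟨k, u⟩ ⟨l, v⟩ huv
      rcases hfin2 k with rfl | rfl <;> rcases hfin2 l with rfl | rfl
      · rw [hf0, hf0] at huv
        rw [Subtype.ext huv]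
      · rw [hf0, hf1] at huv
        exact absurd (huv ▸ u.2) (hU v)
      · rw [hf0, hf1] at huv
        exact absurd (huv ▸ v.2) (hU u)
      · rw [hf1, hf1] at huv
        have := congrArg mate huv
        rw [hmm, hmm] at this
        rw [Subtype.ext this]
    · intro q
      rcases speed_lt_or_lt (hspeed q) with hq | hq
      · exact ⟨(0, ⟨q, hq⟩), rfl⟩
      · refine ⟨(1, ⟨mate q, by rwa [hmm]⟩), ?_⟩
        rw [hf1, hmm]
  have hcard : Fintype.card U = m := by
    have := Fintype.card_of_bijective hf
    simp only [Fintype.card_prod, Fintype.card_fin] at this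
    omega
  let e : Fin m ≃ U := (Fintype.equivFinOfCardEq hcard).symm
  have hsame : ∀ a, s(tail (f a), head (f a)) = s(tail a.2.1, head a.2.1) := fun a =>
    (hends _ _).2 (hfm a)
  refine ⟨((Equiv.refl _).prodCongr e).trans (Equiv.ofBijective f hf), fun j x hx => ?_,
    fun a b => ?_, fun a b hab => ?_⟩
  · exact (e j).2 x hx
  · change s(tail (f (a.1, e a.2)), head (f (a.1, e a.2))) =
      s(tail (f (b.1, e b.2)), head (f (b.1, e b.2))) ↔ _
    rw [hsame, hsame, hends]
    constructor
    · rintro (h1 | h1)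
      · exact e.injective (Subtype.ext h1)
      · exact absurd (h1 ▸ (e a.2).2) (hU (e b.2))
    · intro hab
      exact .inl (by rw [hab])
  · have key : ∀ a, S.foot tail head (f a) = S.foot tail head a.2.1 := fun a => by
      rcases hfm a with h1 | h1 <;> rw [h1]
      exact hfoot _
    change S.foot tail head (f (a.1, e a.2)) = S.foot tail head (f (b.1, e b.2))
    rw [key, key, hab]

/-- The network whose edges are the pairs of a pairing, with diagonal matrices `M j x` and with
`F j x = 1`. -/
theorem IsLayout.exists_network {r : ℕ} {tail head row : Fin (2 * m) → Fin r}
    (h : S.IsLayout tail head row) (hp : S.IsPairing tail head) :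
    ∃ (N : Network r m) (τ : Fin 2 × Fin m ≃ Fin (2 * m)),
      (∀ a x, N.lam a.2 a.1 x = S.speed (τ a) x) ∧ (∀ j x, N.F j x = 1) ∧
      (∀ a, N.origin a = tail (τ a)) ∧ ∀ a, N.target a = head (τ a) := by
  classical
  obtain ⟨τ, hlt, hends, hfoot⟩ := hp.exists_numbering
  let G : SimpleGraph (Fin r) :=
    { Adj := fun v w => ∃ q, s(tail q, head q) = s(v, w)
      symm := ⟨fun v w ⟨q, hq⟩ => ⟨q, hq.trans Sym2.eq_swap⟩⟩
      loopless := ⟨fun v ⟨q, hq⟩ => h.ne q (by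
        rw [Sym2.eq_iff] at hq
        rcases hq with hq | hq <;> exact hq.1.trans hq.2.symm)⟩ }
  have hG : ∀ q, s(tail q, head q) ∈ G.edgeSet := fun q => ⟨q, rfl⟩
  let edge : Fin m → G.edgeSet := fun j => ⟨s(tail (τ (0, j)), head (τ (0, j))), hG _⟩
  have hedge : Function.Bijective edge := by
    constructor
    · intro i j hij
      exact (hends (0, i) (0, j)).1 (congrArg Subtype.val hij)
    · rintro ⟨z, hz⟩
      induction z using Sym2.ind with
      | _ v w =>
        obtain ⟨q, hq⟩ := hz
        refine ⟨(τ.symm q).2, Subtype.ext ?_⟩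
        refine Eq.trans ?_ hq
        have := (hends (0, (τ.symm q).2) (τ.symm q)).2 rfl
        rwa [τ.apply_symm_apply] at this
  let N : Network r m :=
    { graph := G
      edge := Equiv.ofBijective edge hedge
      tail := fun j => S.foot tail head (τ (0, j))
      head := fun j => S.tip tail head (τ (0, j))
      edge_eq := fun j => (mk_foot_tip _ _ _).symm
      no_isolated := fun v => by
        obtain ⟨q, hq⟩ := h.touch v
        refine ⟨(τ.symm q).2, ?_⟩
        have h1 := (hends (0, (τ.symm q).2) (τ.symm q)).2 rfl
        rw [τ.apply_symm_apply, ← mk_foot_tip (S := S) tail head (τ _)] at h1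
        have h2 : v ∈ s(tail q, head q) := by
          rw [Sym2.mem_iff]
          exact hq.imp Eq.symm Eq.symm
        rw [← h1, Sym2.mem_iff] at h2
        exact h2.imp Eq.symm Eq.symm
      M := fun j x => Matrix.diagonal fun k => S.speed (τ (k, j)) x
      lam := fun j k => S.speed (τ (k, j))
      F := fun _ _ => 1
      hyperbolic := hlt
      sign := fun j k => by
        by_cases hJ : τ (k, j) ∈ S.Jplus
        · exact .inl fun x hx => (speed_pos_iff hx).2 hJ
        · refine .inr fun x hx => ?_
          simpa [speed, hJ] using S.c_pos _ x hx
      F_unit := fun _ _ _ => isUnit_one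
      eigen := fun j x _ => by rw [mul_one, one_mul] }
  have hPos : ∀ a, N.Pos a ↔ τ a ∈ S.Jplus := fun a =>
    ⟨fun ha => (speed_pos_iff (by simp)).1 (ha 0 (by simp)), fun ha x hx => (speed_pos_iff hx).2 ha⟩
  have htip : ∀ a b, a.2 = b.2 → S.tip tail head (τ a) = S.tip tail head (τ b) := fun a b hab => by
    have h1 := (hends a b).2 hab
    rwa [← mk_foot_tip (S := S) tail head (τ a), ← mk_foot_tip (S := S) tail head (τ b),
      hfoot a b hab, Sym2.congr_right] at h1
  have hft : ∀ a, N.tail a.2 = S.foot tail head (τ a) := fun a => hfoot (0, a.2) a rfl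
  have htt : ∀ a, N.head a.2 = S.tip tail head (τ a) := fun a => htip (0, a.2) a rfl
  refine ⟨N, τ, fun _ _ => rfl, fun _ _ => rfl, fun a => ?_, fun a => ?_⟩
  · rw [Network.origin, hft, htt]
    by_cases ha : τ a ∈ S.Jplus <;> simp [hPos, ha, foot, tip]
  · rw [Network.target, hft, htt]
    by_cases ha : τ a ∈ S.Jplus <;> simp [hPos, ha, foot, tip]

/-- The Kirchhoff matrix `Phi v` consists of the entries of `Xout` for the values outgoing at `v` and
of `Xin` for the incoming ones, in the rows placed at `v`; there are `k_v` such rows. -/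
theorem IsLayout.graphRealizable {r : ℕ} {tail head row : Fin (2 * m) → Fin r}
    (h : S.IsLayout tail head row) (hp : S.IsPairing tail head) : S.GraphRealizable := by
  classical
  obtain ⟨N, τ, hlam, hF, horigin, htarget⟩ := h.exists_network hp
  have hnum : ∀ v, Nat.card {i // row i = v} = N.numOut v := fun v => by
    rw [h.card v]
    refine (Nat.card_congr (τ.subtypeEquiv fun a => ?_)).symm
    rw [isOut_iff, horigin]
  let ρ : Fin (2 * m) ≃ Σ v : Fin r, Fin (N.numOut v) :=
    (Equiv.sigmaFiberEquiv row).symm.trans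
      (Equiv.sigmaCongrRight fun v => Finite.equivFinOfCardEq (hnum v))
  have hρ : ∀ i, (ρ i).1 = row i := fun i => rfl
  have hρs : ∀ v s, row (ρ.symm ⟨v, s⟩) = v := fun v s => by
    rw [← hρ, ρ.apply_symm_apply]
  have hnot : ∀ v a, N.IsIn v a → ¬ N.IsOut v a := fun v a hi ho => by
    rw [isIn_iff, htarget] at hi
    rw [isOut_iff, horigin] at ho
    exact h.ne _ (ho.trans hi.symm)
  let Phi : N.Kirchhoff := fun v s a =>
    if N.IsOut v (a.1, a.2.1) then S.Xout (ρ.symm ⟨v, s⟩) (τ (a.1, a.2.1))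
    else S.Xin (ρ.symm ⟨v, s⟩) (τ (a.1, a.2.1))
  have hpsi : ∀ v, psi Phi v = Phi v := fun v => by
    simp only [psi, hF]
    rw [show (fun _ : {j // N.Incident v j} => (1 : Matrix (Fin 2) (Fin 2) ℝ)) = 1 from rfl,
      Matrix.blockDiagonal_one, Matrix.mul_one]
  have hout : ∀ v s a, psiOut Phi v s a = S.Xout (ρ.symm ⟨v, s⟩) (τ a.1) := fun v s a => by
    have := a.2
    simp only [psiOut, hpsi]
    exact if_pos this
  have hin : ∀ v s a, psiIn Phi v s a = S.Xin (ρ.symm ⟨v, s⟩) (τ a.1) := fun v s a => by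
    have := hnot v a.1 a.2
    simp only [psiIn, hpsi]
    exact if_neg this
  have hlam' : ∀ q x, N.lam (τ.symm q).2 (τ.symm q).1 x = S.speed q x := fun q x => by
    rw [hlam, τ.apply_symm_apply]
  refine ⟨r, N, Phi, ⟨ρ, τ.symm, fun j hj x hx => ?_, fun j hj x hx => ?_, ?_, ?_⟩, ?_, ?_, ?_⟩
  · simp [hlam', speed, hj]
  · simp [hlam', speed, hj]
  · ext i j
    by_cases ho : N.IsOut (ρ i).1 (τ.symm j)
    · have h1 := (globalOut_of_isOut Phi (s := (ρ i).2) ho).trans (hout _ _ _)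
      rw [Sigma.eta, ρ.symm_apply_apply, τ.apply_symm_apply] at h1
      exact h1.symm
    · have h1 : globalOut Phi (ρ i) (τ.symm j) = 0 := by simp [globalOut, ho]
      refine Eq.trans ?_ h1.symm
      by_contra hij
      refine ho (isOut_iff.2 ?_)
      rw [horigin, τ.apply_symm_apply, hρ, h.out_supp i j hij]
  · ext i j
    by_cases ho : N.IsIn (ρ i).1 (τ.symm j)
    · have h1 := (globalIn_of_isIn Phi (s := (ρ i).2) ho).trans (hin _ _ _)
      rw [Sigma.eta, ρ.symm_apply_apply, τ.apply_symm_apply] at h1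
      exact h1.symm
    · have h1 : globalIn Phi (ρ i) (τ.symm j) = 0 := by simp [globalIn, ho]
      refine Eq.trans ?_ h1.symm
      by_contra hij
      refine ho (isIn_iff.2 ?_)
      rw [htarget, τ.apply_symm_apply, hρ, h.in_supp i j hij]
  · refine fun v _ => ⟨fun s => ?_, fun a => ?_⟩
    · obtain ⟨q, hq⟩ := (h.nz (ρ.symm ⟨v, s⟩)).2
      refine ⟨⟨τ.symm q, isOut_iff.2 ?_⟩, ?_⟩
      · rw [horigin, τ.apply_symm_apply, ← h.out_supp _ _ hq, hρs]
      · rwa [hout, τ.apply_symm_apply]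
    · obtain ⟨i, hi⟩ := (h.nz (τ a.1)).1
      obtain rfl : (ρ i).1 = v := by
        rw [← isOut_iff.1 a.2, horigin, hρ, h.out_supp _ _ hi]
      refine ⟨(ρ i).2, ?_⟩
      rwa [hout, Sigma.eta, ρ.symm_apply_apply]
  · intro v _
    ext l j
    have hlj : tail (τ l.1) = head (τ j.1) := by
      rw [← horigin, ← htarget, isOut_iff.1 l.2, isIn_iff.1 j.2]
    obtain ⟨i, hi, hi'⟩ := A_ne_zero.1 (h.conn _ _ hlj)
    obtain rfl : (ρ i).1 = v := by
      rw [← isOut_iff.1 l.2, horigin, hρ, h.out_supp _ _ hi]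
    refine if_pos ⟨(ρ i).2, ?_, ?_⟩
    · rwa [hin, Sigma.eta, ρ.symm_apply_apply]
    · rwa [hout, Sigma.eta, ρ.symm_apply_apply]
  · intro v hv
    rw [Matrix.isIrreducible_iff_transGen (sourceConn_nonneg Phi)]
    intro a b
    have hab : tail (τ a.1) = tail (τ b.1) := by
      rw [← horigin, ← horigin, isOut_iff.1 a.2, isOut_iff.1 b.2]
    have hchain := h.source _ _ hab fun j hj => isSource_iff.1 hv (τ.symm j) (by
      rw [htarget, τ.apply_symm_apply, hj, ← horigin, isOut_iff.1 a.2])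
    -- A link between arcs starting at `v` comes from a condition at `v`.
    have step : ∀ p (hp : N.IsOut v (τ.symm p)) q, S.Linked p q → ∃ hq : N.IsOut v (τ.symm q),
        0 < Network.sourceConn Phi v ⟨τ.symm p, hp⟩ ⟨τ.symm q, hq⟩ := by
      rintro p hp q ⟨i, hip, hiq⟩
      have hi : (ρ i).1 = v := by
        rw [← isOut_iff.1 hp, horigin, hρ, h.out_supp _ _ hip, τ.apply_symm_apply]
      subst hi
      refine ⟨isOut_iff.2 ?_, (sourceConn_pos_iff Phi).2 ⟨(ρ i).2, ?_, ?_⟩⟩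
      · rw [horigin, τ.apply_symm_apply, hρ, h.out_supp _ _ hiq]
      · rwa [hout, Sigma.eta, ρ.symm_apply_apply, τ.apply_symm_apply]
      · rwa [hout, Sigma.eta, ρ.symm_apply_apply, τ.apply_symm_apply]
    have lift : ∀ p (hp : N.IsOut v (τ.symm p)) q, Relation.TransGen S.Linked p q →
        ∃ hq : N.IsOut v (τ.symm q), Relation.TransGen
          (fun a b => 0 < Network.sourceConn Phi v a b) ⟨τ.symm p, hp⟩ ⟨τ.symm q, hq⟩ := by
      intro p hp q hpq
      induction hpq with
      | single e => exact (step p hp _ e).imp fun _ => .single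
      | tail _ e ih =>
        obtain ⟨hb, ih⟩ := ih
        exact (step _ hb _ e).imp fun _ => ih.tail
    simpa using (lift (τ a.1) (by simpa using a.2) (τ b.1) hchain).2

theorem graphRealizable_iff : S.GraphRealizable ↔
    S.NoZeroRowCol ∧ IsLineDigraphMatrix S.A ∧ S.ZeroInRowsLocal ∧ S.Balanced ∧ S.Collapsible := by
  constructor
  · rintro ⟨r, N, Phi, h⟩
    obtain ⟨σ, row, hL, hP⟩ := h.exists_isLayout
    exact ⟨hL.nz, hL.isLineDigraphMatrix, hL.isLocal.loc, hL.balanced, hL.collapsible hP⟩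
  · rintro ⟨ha, hb, hc, he, hd⟩
    obtain ⟨n, tail, head, row, hL, hP⟩ := IsLocal.exists_isLayout
      ⟨ha, row_eq_of_isLineDigraphMatrix hb, hc⟩ he hd
    exact hL.graphRealizable hP

end PortHamiltonian

end

theorem mainTheorem1 {m : ℕ} (S : PortHamiltonian m) :
    (S.GraphRealizable ↔
      S.NoZeroRowCol ∧ IsLineDigraphMatrix S.A ∧ S.ZeroInRowsLocal ∧ S.Balanced ∧
        S.Collapsible) ∧
    (IsUnit S.Xout.det →
      (S.GraphRealizable ↔
        S.NoZeroRowCol ∧ IsLineDigraphMatrix S.A ∧ S.ZeroInRowsLocal ∧ S.Collapsible)) ∧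
    (0 < m → S.Indecomposable → ∀ (r : ℕ) (N : Network r m) (Phi : N.Kirchhoff),
      S.IsRealization N Phi → N.graph.Connected) := by
  refine ⟨PortHamiltonian.graphRealizable_iff, fun hdet => PortHamiltonian.graphRealizable_iff.trans
    ⟨fun ⟨ha, hb, hc, _, hd⟩ => ⟨ha, hb, hc, hd⟩, fun ⟨ha, hb, hc, hd⟩ => ?_⟩,
    fun hm hS r N Phi h => h.connected hm hS⟩
  have hL : S.IsLocal := ⟨ha, PortHamiltonian.row_eq_of_isLineDigraphMatrix hb, hc⟩
  exact ⟨ha, hb, hc, hL.balanced_of_isUnit_det hdet, hd⟩
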